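/- Let $d\ge 1$, $B>0$, and consider the Gaussian sequence model: one observes $X\sim N(\theta,I)$ in $\mathbb R^d$ with $\theta\in\Theta=\{\theta:\|\theta\|_2\le B\}$. The set $\mathcal D$ of deterministic estimators consists of the measurable maps $f:\mathbb R^d\to\Theta$; a randomized estimator is a random element of $\mathcal D$ drawn independently of $X$. The risk is $R(f,\theta)=\mathbb E_{X\sim N(\theta,I)}\|f(X)-\theta\|_2^2$ (averaged also over the draw of $f$ if $f$ is randomized), $R(f,\Pi)=\mathbb E_{\theta\sim\Pi}R(f,\theta)$ for a prior $\Pi$, and $R^*=\inf_f\sup_{\theta\in\Theta}R(f,\theta)$, the infimum over all randomized estimators. Let $T\ge1$ be an integer, $\eta=\frac1{B(B+1)\sqrt T}$, $w=\frac{B}{T^{3/2}}$, $N_1=\lceil T^3/(B+1)^2\rceil$, $N_2=\lceil T^4/(B+1)^2\rceil$, and let $b_j=jw$ for $1\le j\le\lfloor B/w\rfloor$ be the grid on $[0,B]$. Run the following algorithm for $t=1,\dots,T$. (Maximization oracle.) Given the estimators $\hat\theta_1,\dots,\hat\theta_{t-1}$ and $\sigma\in\mathbb R$, draw for every $i<t$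 and every $j$ fresh independent samples $X_{ij1},\dots,X_{ijN_1}\sim N(b_je_1,I)$, and return a grid point $b_j$ that maximizes $\sum_{i<t}\frac1{N_1}\sum_{k=1}^{N_1}\|\hat\theta_i(X_{ijk})-b_je_1\|_2^2+\sigma b_j$, ties being broken by any fixed measurable rule. Let $P_t$ be the law of the output when $\sigma$ is exponential with rate $\eta$, let $\beta_1,\dots,\beta_{N_2}$ be independent samples from $P_t$ (each obtained from its own call of the oracle), and let $\hat P_t$ be their empirical distribution. (Minimization oracle.) Let $$\hat\theta_t(X)=\left(\frac{\sum_{i=1}^{N_2}w_i\beta_iA(\beta_i\|X\|_2)}{\sum_{i=1}^{N_2}w_i}\right)\frac{X}{\|X\|_2},\qquad w_i=\beta_i^{1-d/2}e^{-\beta_i^2/2}I_{d/2-1}(\beta_i\|X\|_2),\qquad A(\gamma)=\frac{I_{d/2}(\gamma)}{I_{d/2-1}(\gamma)},$$ with $\hat\theta_t(0)=0$, where $I_\nu$ is the modified Bessel function of the first kind of order $\nu$. Let $\hat\theta_{\mathrm{avg}}=\frac1T\sum_{t=1}^T\hat\theta_t$ and $\hat P_{\mathrm{avg}}=\frac1T\sum_{t=1}^T\hat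 P_t$, and let $\hat P_{\mathrm{LFP}}$ be the radial extension of $\hat P_{\mathrm{avg}}$: the law of $bu$, where $b\sim\hat P_{\mathrm{avg}}$ and $u$ is independent of $b$ and uniform on the unit sphere (it has density proportional to $\|\theta\|_2^{1-d}\,\hat P_{\mathrm{avg}}(\|\theta\|_2)$ with respect to surface measure on the spheres that carry it). Then $\hat\theta_{\mathrm{avg}}\in\mathcal D$, and $\hat P_{\mathrm{LFP}}$ is a probability measure on $\Theta$. Moreover, there are absolute constants $C>0$ and $k\in\mathbb N$ such that for all $d\ge1$, $B>0$, $T\ge1$ and $\delta\in(0,1)$, with $$\varepsilon=C\,\frac{B^2(B+1)}{\sqrt T}\Big(1+\log\frac T\delta\Big)^k:$$ 1. With probability at least $1-\delta$, $\ \sup_{\|\theta\|_2\le B}R(\hat\theta_{\mathrm{avg}},\theta)\le R^*+\varepsilon$. 2. With probability at least $1-\delta$, $\ \inf_{f\in\mathcal D}R(f,\hat P_{\mathrm{LFP}})\ge R^*-\varepsilon$. -/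

import Mathlib

open MeasureTheory ProbabilityTheory
open scoped ENNReal

noncomputable section

namespace GaussianSequence

/-- The sample space and the ambient parameter space `ℝ^d`, with the Euclidean norm. -/
abbrev E (d : ℕ) : Type := EuclideanSpace ℝ (Fin d)

/-- The law `N(θ, I)` on `ℝ^d`. -/
def normalLaw {d : ℕ} (θ : E d) : Measure (E d) := multivariateGaussian θ 1

/-- The first standard basis vector of `ℝ^d`. -/
def e₁ (d : ℕ) [NeZero d] : E d := EuclideanSpace.single (0 : Fin d) (1 : ℝ)

/-! ### The statistical game -/

/-- The parameter space `{θ : ‖θ‖ ≤ B}`. -/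
def paramSpace (d : ℕ) (B : ℝ) : Set (E d) := Metric.closedBall 0 B

/-- The deterministic estimators: measurable maps from `ℝ^d` to the parameter space. -/
def detEstimators (d : ℕ) (B : ℝ) : Set (E d → E d) :=
  {f | Measurable f ∧ ∀ x, f x ∈ paramSpace d B}

/-- The risk `E_{X ∼ N(θ, I)} ‖f(X) - θ‖²`, as an extended nonnegative real. -/
def risk {d : ℕ} (f : E d → E d) (θ : E d) : ℝ≥0∞ :=
  ∫⁻ x, ENNReal.ofReal (‖f x - θ‖ ^ 2) ∂(normalLaw θ)

/-- The integrated risk `E_{θ ∼ π} R(f, θ)`. -/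
def integratedRisk {d : ℕ} (f : E d → E d) (π : Measure (E d)) : ℝ≥0∞ :=
  ∫⁻ θ, risk f θ ∂π

/-- The worst-case risk over the parameter space. -/
def worstCaseRisk {d : ℕ} (B : ℝ) (f : E d → E d) : ℝ≥0∞ :=
  ⨆ θ ∈ paramSpace d B, risk f θ

/-- A randomized estimator: a deterministic estimator drawn at random, by a random variable
independent of the data. -/
structure RandomizedEstimator (d : ℕ) (B : ℝ) where
  Ω : Type
  mΩ : MeasurableSpace Ω
  law : Measure Ω
  isProb : IsProbabilityMeasure law
  est : Ω → E d → E d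
  measurable_est : Measurable (Function.uncurry est)
  est_mem : ∀ ω x, est ω x ∈ paramSpace d B

/-- The risk of a randomized estimator, averaged over its internal randomness too. -/
def RandomizedEstimator.risk {d : ℕ} {B : ℝ} (r : RandomizedEstimator d B) (θ : E d) : ℝ≥0∞ :=
  @lintegral r.Ω r.mΩ r.law fun ω => GaussianSequence.risk (r.est ω) θ

/-- The minimax risk `R*`. -/
def minimaxRisk (d : ℕ) (B : ℝ) : ℝ≥0∞ :=
  ⨅ r : RandomizedEstimator d B, ⨆ θ ∈ paramSpace d B, r.risk θ

/-- The Bayes risk of a prior. -/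
def bayesRisk (d : ℕ) (B : ℝ) (π : Measure (E d)) : ℝ≥0∞ :=
  ⨅ f ∈ detEstimators d B, integratedRisk f π

/-! ### The minimization oracle -/

/-- The modified Bessel function of the first kind
`I_ν(x) = ∑ₘ (x / 2)^(2 m + ν) / (m! Γ(m + ν + 1))`, for real order `ν` and `x > 0`. -/
def besselI (ν x : ℝ) : ℝ :=
  ∑' m : ℕ, (x / 2) ^ (2 * (m : ℝ) + ν) / ((m.factorial : ℝ) * Real.Gamma ((m : ℝ) + ν + 1))

/-- `A(γ) = I_{d/2}(γ) / I_{d/2-1}(γ)`. -/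
def besselRatio (d : ℕ) (γ : ℝ) : ℝ :=
  besselI ((d : ℝ) / 2) γ / besselI ((d : ℝ) / 2 - 1) γ

/-- The weight `b^{1-d/2} e^{-b²/2} I_{d/2-1}(b r)` of a sampled radius `b` at an observation of
norm `r`. -/
def weight (d : ℕ) (b r : ℝ) : ℝ :=
  b ^ (1 - (d : ℝ) / 2) * Real.exp (-b ^ 2 / 2) * besselI ((d : ℝ) / 2 - 1) (b * r)

/-- The minimization oracle: the estimator computed from the sampled radii `b 0, …, b (N - 1)`. -/
def minOracle {d N : ℕ} (b : Fin N → ℝ) (x : E d) : E d :=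
  ((∑ i, weight d (b i) ‖x‖ * (b i * besselRatio d (b i * ‖x‖))) / ∑ i, weight d (b i) ‖x‖) •
    (‖x‖⁻¹ • x)

/-! ### The maximization oracle -/

/-- The number `B / w` of grid points, rounded down. -/
def gridSize (B w : ℝ) : ℕ := ⌊B / w⌋₊

/-- The grid points `w, 2 w, …, ⌊B / w⌋ w` of `[0, B]`. -/
def gridPoint (B w : ℝ) (j : Fin (gridSize B w)) : ℝ := ((j : ℕ) + 1) * w

/-- The Gaussian samples drawn in one call of the maximization oracle in the round that has `t`
previous estimators: `N₁` vectors for each estimator and grid point. -/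
abbrev Samples (d : ℕ) (B w : ℝ) (N₁ t : ℕ) : Type :=
  Fin t → Fin (gridSize B w) → Fin N₁ → E d

/-- The law of these samples: independent, those for the grid point `b_j` being `N(b_j e₁, I)`. -/
def samplesLaw (d : ℕ) [NeZero d] (B w : ℝ) (N₁ t : ℕ) : Measure (Samples d B w N₁ t) :=
  Measure.pi fun _ : Fin t => Measure.pi fun j : Fin (gridSize B w) =>
    Measure.pi fun _ : Fin N₁ => normalLaw (gridPoint B w j • e₁ d)

/-- The empirical objective of the maximization oracle at the grid points: the sum over the
previous estimators of the Monte Carlo estimate of `R(f_i, b_j e₁)`, plus `σ b_j`. -/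
def objective {d : ℕ} [NeZero d] {B w : ℝ} {N₁ t : ℕ} (f : Fin t → E d → E d) (σ : ℝ)
    (X : Samples d B w N₁ t) (j : Fin (gridSize B w)) : ℝ :=
  (∑ i, (1 / (N₁ : ℝ)) * ∑ k, ‖f i (X i j k) - gridPoint B w j • e₁ d‖ ^ 2) +
    σ * gridPoint B w j

/-- A measurable rule that picks a maximizer of a function on `Fin n` (it only matters how it
breaks ties). -/
structure ArgmaxRule (n : ℕ) (pick : (Fin n → ℝ) → Fin n) : Prop where
  measurable : Measurable pick
  le_pick : ∀ (g : Fin n → ℝ) (j : Fin n), g j ≤ g (pick g)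

/-- The maximization oracle: the grid point that maximizes the empirical objective. -/
def maxOracle {d : ℕ} [NeZero d] {B w : ℝ} {N₁ t : ℕ}
    (pick : (Fin (gridSize B w) → ℝ) → Fin (gridSize B w)) (f : Fin t → E d → E d) (σ : ℝ)
    (X : Samples d B w N₁ t) : ℝ :=
  gridPoint B w (pick (objective f σ X))

/-! ### Follow the perturbed leader -/

/-- The randomness of a run of `T` rounds. In round `t` (counted from `0`), each of the `N₂` draws
from `P_t` uses a perturbation `σ` and the Gaussian samples of one call of the maximization
oracle. -/
abbrev Seed (d : ℕ) (B w : ℝ) (N₁ N₂ T : ℕ) : Type :=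
  (t : Fin T) → Fin N₂ → ℝ × Samples d B w N₁ t

/-- The law of the randomness: everything is independent, and the perturbations are exponential
with rate `η`. -/
def seedLaw (d : ℕ) [NeZero d] (B η w : ℝ) (N₁ N₂ T : ℕ) : Measure (Seed d B w N₁ N₂ T) :=
  Measure.pi fun t : Fin T => Measure.pi fun _ : Fin N₂ =>
    (expMeasure η).prod (samplesLaw d B w N₁ t)

/-- The radii drawn in round `t`. Given the earlier rounds, they are `N₂` independent samples from
the law `P_t` of the output of the maximization oracle, applied to a perturbation `σ ∼ Exp(η)` and
to the estimators that the minimization oracle returned in the rounds `0, …, t - 1`. -/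
def radii {d : ℕ} [NeZero d] {B w : ℝ} {N₁ N₂ T : ℕ}
    (pick : (Fin (gridSize B w) → ℝ) → Fin (gridSize B w)) (ω : Seed d B w N₁ N₂ T)
    (t : Fin T) : Fin N₂ → ℝ := fun s =>
  maxOracle pick (fun i : Fin t => minOracle (radii pick ω ⟨i, i.2.trans t.2⟩)) (ω t s).1 (ω t s).2
termination_by t.val
decreasing_by exact i.2

/-- The estimator `θ̂_t` returned by the minimization oracle in round `t`. -/
def iterate {d : ℕ} [NeZero d] {B w : ℝ} {N₁ N₂ T : ℕ}
    (pick : (Fin (gridSize B w) → ℝ) → Fin (gridSize B w)) (ω : Seed d B w N₁ N₂ T)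
    (t : Fin T) : E d → E d := minOracle (radii pick ω t)

/-- The averaged estimator `(1 / T) ∑ₜ θ̂_t`. -/
def avgEstimator {d : ℕ} [NeZero d] {B w : ℝ} {N₁ N₂ T : ℕ}
    (pick : (Fin (gridSize B w) → ℝ) → Fin (gridSize B w)) (ω : Seed d B w N₁ N₂ T) : E d → E d :=
  fun x => (1 / (T : ℝ)) • ∑ t, iterate pick ω t x

/-- The empirical distribution of a finite sample. -/
def empirical {N : ℕ} (b : Fin N → ℝ) : Measure ℝ := (N : ℝ≥0∞)⁻¹ • ∑ s, Measure.dirac (b s)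

/-- The mixture `(1 / T) ∑ₜ P̂_t` of the empirical distributions of the rounds. -/
def avgPrior {d : ℕ} [NeZero d] {B w : ℝ} {N₁ N₂ T : ℕ}
    (pick : (Fin (gridSize B w) → ℝ) → Fin (gridSize B w)) (ω : Seed d B w N₁ N₂ T) : Measure ℝ :=
  (T : ℝ≥0∞)⁻¹ • ∑ t, empirical (radii pick ω t)

/-- The uniform probability distribution on the unit sphere of `ℝ^d`: the normalized surface
measure. -/
def sphereUniform (d : ℕ) : Measure (Metric.sphere (0 : E d) 1) :=
  ((volume : Measure (E d)).toSphere Set.univ)⁻¹ • (volume : Measure (E d)).toSphere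

/-- The radial extension of a distribution `μ` of radii: the law of `b u`, where `b ∼ μ` and `u`
is uniform on the unit sphere and independent of `b`. For a discrete `μ` on `(0, ∞)`, its density
with respect to the surface measure on the spheres that carry it is proportional to
`‖θ‖^{1-d} μ{‖θ‖}`, since the sphere of radius `b` has area proportional to `b^{d-1}`. -/
def radialExtension (d : ℕ) (μ : Measure ℝ) : Measure (E d) :=
  (μ.prod (sphereUniform d)).map fun p => p.1 • (p.2 : E d)

/-- The approximately least favorable prior `P̂_LFP`. -/
def lfPrior {d : ℕ} [NeZero d] {B w : ℝ} {N₁ N₂ T : ℕ}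
    (pick : (Fin (gridSize B w) → ℝ) → Fin (gridSize B w)) (ω : Seed d B w N₁ N₂ T) :
    Measure (E d) := radialExtension d (avgPrior pick ω)

/-! ### The parameters and the rate -/

/-- `η = 1 / (B (B + 1) √T)`. -/
def etaParam (B : ℝ) (T : ℕ) : ℝ := 1 / (B * (B + 1) * Real.sqrt T)

/-- The grid width `w = B / T^{3/2}`. -/
def widthParam (B : ℝ) (T : ℕ) : ℝ := B / (T : ℝ) ^ (3 / 2 : ℝ)

/-- `N₁ = T³ / (B + 1)²`, rounded up. -/
def N₁Param (B : ℝ) (T : ℕ) : ℕ := ⌈(T : ℝ) ^ 3 / (B + 1) ^ 2⌉₊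

/-- `N₂ = T⁴ / (B + 1)²`, rounded up. -/
def N₂Param (B : ℝ) (T : ℕ) : ℕ := ⌈(T : ℝ) ^ 4 / (B + 1) ^ 2⌉₊

/-- The error `C B² (B + 1) / √T` times the logarithmic factor `(1 + log (T / δ))^k`. -/
def errorBound (C : ℝ) (k : ℕ) (B : ℝ) (T : ℕ) (δ : ℝ) : ℝ≥0∞ :=
  ENNReal.ofReal (C * (B ^ 2 * (B + 1) / Real.sqrt T) * (1 + Real.log (T / δ)) ^ k)

end GaussianSequence

end

/-! Everything follows from one inequality: outside an event of probability at most δ, the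
worst-case risk of θ̂_avg is at most the Bayes risk of P̂_LFP plus ε
(`worstCaseRisk_avgEstimator_le`). The Bayes risk of any prior on the ball is at most R*, and R* is
at most the worst-case risk of any estimator (`bayesRisk_le_minimaxRisk`,
`minimaxRisk_le_worstCaseRisk`). So this one gap bounds both errors, and no minimax theorem is
needed.

The statistician's side is exact. Averaging the Gaussian density at x over the sphere of radius b
gives, up to a factor depending only on ‖x‖, the Bessel weight of b, and the first moment brings in
the factor b A(b‖x‖). Hence θ̂_t is the posterior mean for the radial extension of P̂_t
(`minOracle_eq_posteriorMean`) and is Bayes optimal for it. The average over t of the values of the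
rounds is therefore a lower bound for the Bayes risk of the mixture. By convexity of the loss, the
risk of θ̂_avg is at most the average of the risks of the θ̂_t.

Nature's side is online learning in dimension one. Each θ̂_t commutes with rotations, so its risk
depends on ‖θ‖ only, and nature picks a radius b with reward R(θ̂_t, b e₁). This reward is
L-Lipschitz with L = 8B(B+1), because the L¹ distance of two Gaussians is at most twice the distance
of their means (`realRisk_sub_le`). Playing the leader in hindsight costs B/η in total. The radius
of the leader is monotone in σ, and a near-optimal choice before round t lies, up to its error,
between the leaders after round t for σ - 2L and σ + 2L (`abs_sub_leader_le`). Shifting an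
exponential variable changes the expectation of a function with values in [0, B] by little, so each
round loses only about ηL²B plus the expected Monte Carlo error (`integral_leader_le`).

The randomness of the run matters only when P_t is replaced by P̂_t. For a fixed run the rewards are
a fixed sequence and P_t is a function of the past draws, so the regret bound holds run by run as
soon as the empirical frequencies are accurate (`sum_gridRisk_le`). Given the past, the draws of a
round are independent with law P_t; Hoeffding's inequality and a union bound over rounds and grid
points finish the argument. -/

noncomputable section

namespace GaussianSequence

/-! ### Gaussian densities -/

/-- The density of `N(θ, I)` with respect to the volume. -/
def gaussDensity (d : ℕ) (θ x : E d) : ℝ :=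
  (2 * Real.pi) ^ (-(d : ℝ) / 2) * Real.exp (-‖x - θ‖ ^ 2 / 2)

lemma gaussDensity_pos (d : ℕ) (θ x : E d) : 0 < gaussDensity d θ x := by
  unfold gaussDensity; positivity

lemma continuous_gaussDensity (d : ℕ) :
    Continuous (fun p : E d × E d => gaussDensity d p.1 p.2) := by
  unfold gaussDensity; fun_prop

lemma measurable_gaussDensity (d : ℕ) (θ : E d) : Measurable (gaussDensity d θ) :=
  ((continuous_gaussDensity d).comp (Continuous.prodMk_right θ)).measurable

lemma gaussDensity_zero_sub (d : ℕ) (θ x : E d) : gaussDensity d 0 (x - θ) = gaussDensity d θ x := by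
  simp [gaussDensity]

lemma integrable_gaussDensity_zero (d : ℕ) : Integrable (gaussDensity d 0) := by
  unfold gaussDensity
  refine Integrable.const_mul ?_ _
  have := (GaussianFourier.integrable_cexp_neg_mul_sq_norm_add (V := E d) (b := 1 / 2)
    (by norm_num) 0 0).norm
  refine this.congr (.of_forall fun x => ?_)
  simp only [Complex.norm_exp]
  congr 1
  simp [← Complex.ofReal_pow]
  ring

/-- Both sides are finite measures with the same characteristic function: the Fourier integral of
the density is known in closed form. -/
lemma stdGaussian_eq_withDensity (d : ℕ) :
    stdGaussian (E d) = volume.withDensity (fun x => ENNReal.ofReal (gaussDensity d 0 x)) := by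
  have hfin : IsFiniteMeasure
      (volume.withDensity (fun x => ENNReal.ofReal (gaussDensity d 0 x))) :=
    isFiniteMeasure_withDensity_ofReal (integrable_gaussDensity_zero d).2
  apply Measure.ext_of_charFun
  ext t
  rw [charFun_stdGaussian, charFun_apply, integral_withDensity_eq_integral_toReal_smul
    (measurable_gaussDensity d 0).ennreal_ofReal (by simp)]
  have h2 := GaussianFourier.integral_cexp_neg_mul_sq_norm_add (V := E d) (b := 1 / 2)
    (by norm_num) Complex.I t
  have hpi : (0 : ℝ) < 2 * Real.pi := by positivity
  calc _ = (((2 * Real.pi) ^ (-(d : ℝ) / 2) : ℝ) : ℂ) *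
        (((2 * Real.pi) ^ ((d : ℝ) / 2) : ℝ) : ℂ) * Complex.exp (-‖t‖ ^ 2 / 2) := by
        rw [← Complex.ofReal_mul, ← Real.rpow_add hpi]
        simp [neg_div]
    _ = (((2 * Real.pi) ^ (-(d : ℝ) / 2) : ℝ) : ℂ) *
        ∫ v : E d, Complex.exp (-(1 / 2) * ‖v‖ ^ 2 + Complex.I * (inner ℝ t v : ℝ)) := by
        rw [h2, mul_assoc]
        congr 2
        · rw [Complex.ofReal_cpow hpi.le]
          simp
          ring_nf
        · congr 1
          rw [Complex.I_sq]; ring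
    _ = _ := by
        rw [← integral_const_mul]
        congr 1
        ext v
        rw [ENNReal.toReal_ofReal (gaussDensity_pos _ _ _).le, Complex.exp_add, gaussDensity]
        simp [real_inner_comm]
        ring_nf

lemma normalLaw_eq_map {d : ℕ} (θ : E d) :
    normalLaw θ = (stdGaussian (E d)).map (fun x => θ + x) := by
  simp [normalLaw, multivariateGaussian]

instance {d : ℕ} (θ : E d) : IsProbabilityMeasure (normalLaw θ) := by
  unfold normalLaw; infer_instance

lemma normalLaw_eq_withDensity {d : ℕ} (θ : E d) :
    normalLaw θ = volume.withDensity (fun x => ENNReal.ofReal (gaussDensity d θ x)) := by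
  rw [normalLaw_eq_map, stdGaussian_eq_withDensity]
  ext s hs
  rw [Measure.map_apply (by fun_prop) hs, withDensity_apply _ (hs.preimage (by fun_prop)),
    withDensity_apply _ hs, ← lintegral_indicator hs,
    ← lintegral_indicator (hs.preimage (by fun_prop)),
    ← lintegral_add_left_eq_self (fun x => s.indicator
      (fun x => ENNReal.ofReal (gaussDensity d θ x)) x) θ]
  congr 1
  ext x
  by_cases hx : θ + x ∈ s <;> simp [Set.indicator, gaussDensity, hx]

lemma normalLaw_map_isometry {d : ℕ} (Q : E d ≃ₗᵢ[ℝ] E d) (θ : E d) :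
    (normalLaw θ).map Q = normalLaw (Q θ) := by
  have hQ : Measurable Q := Q.continuous.measurable
  rw [normalLaw_eq_map, normalLaw_eq_map, Measure.map_map hQ (by fun_prop)]
  conv_rhs => rw [← stdGaussian_map Q, Measure.map_map (by fun_prop) hQ]
  congr 1
  ext x : 1
  simp

lemma integral_normalLaw {d : ℕ} (θ : E d) (g : E d → ℝ) :
    ∫ x, g x ∂(normalLaw θ) = ∫ x, gaussDensity d θ x * g x := by
  rw [normalLaw_eq_withDensity, integral_withDensity_eq_integral_toReal_smul
    (measurable_gaussDensity d θ).ennreal_ofReal (by simp)]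
  congr 1
  ext x
  rw [ENNReal.toReal_ofReal (gaussDensity_pos _ _ _).le, smul_eq_mul]

lemma integrable_gaussDensity {d : ℕ} (θ : E d) : Integrable (gaussDensity d θ) := by
  have := (integrable_gaussDensity_zero d).comp_sub_right θ
  simpa only [gaussDensity_zero_sub] using this

lemma integrable_normalLaw_iff {d : ℕ} (θ : E d) (g : E d → ℝ) :
    Integrable g (normalLaw θ) ↔ Integrable fun x => gaussDensity d θ x * g x := by
  rw [normalLaw_eq_withDensity, integrable_withDensity_iff_integrable_smul'
    (measurable_gaussDensity d θ).ennreal_ofReal (by simp)]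
  refine integrable_congr (.of_forall fun x => ?_)
  simp only
  rw [ENNReal.toReal_ofReal (gaussDensity_pos _ _ _).le, smul_eq_mul]

/-- Completing the square: the exponential tilt of the density at 0 is `exp (‖h‖ ^ 2 / 2)` times the
density at `h`, which has mass one. -/
lemma integral_exp_inner_stdGaussian (d : ℕ) (h : E d) :
    ∫ z, Real.exp (inner ℝ h z) ∂(normalLaw (0 : E d)) = Real.exp (‖h‖ ^ 2 / 2) := by
  rw [integral_normalLaw]
  have h1 : ∫ z, gaussDensity d h z = 1 := by
    have := integral_normalLaw h (fun _ => 1)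
    simpa using this.symm
  rw [← mul_one (Real.exp _), ← h1, ← integral_const_mul]
  congr 1
  ext z
  simp only [gaussDensity, sub_zero]
  rw [mul_assoc, ← Real.exp_add, mul_left_comm, ← Real.exp_add, norm_sub_sq_real,
    real_inner_comm h z]
  ring_nf

lemma integrable_exp_inner_stdGaussian (d : ℕ) (h : E d) :
    Integrable (fun z => Real.exp (inner ℝ h z)) (normalLaw (0 : E d)) := by
  -- A non-integrable function would have integral 0 by convention, but the value is positive.
  by_contra hc
  have := integral_exp_inner_stdGaussian d h
  rw [integral_undef hc] at this
  exact (Real.exp_pos _).ne this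

/-- The `L¹` distance of two standard Gaussian densities. -/
lemma integral_abs_gaussDensity_sub_le (d : ℕ) (h : E d) :
    ∫ x, |gaussDensity d h x - gaussDensity d 0 x| ≤ 2 * ‖h‖ := by
  have hint := (integrable_gaussDensity h).sub (integrable_gaussDensity (0 : E d))
  have h1 (θ : E d) : ∫ z, gaussDensity d θ z = 1 := by
    have := integral_normalLaw θ (fun _ => 1)
    simpa using this.symm
  -- For ‖h‖ ≥ 1 the trivial bound 2 suffices. Otherwise the likelihood ratio ρ satisfies E(ρ - 1)²
  -- = exp(‖h‖²) - 1 ≤ 2‖h‖², and the L¹ norm is controlled by this second moment.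
  by_cases hh : 1 ≤ ‖h‖
  · calc ∫ x, |gaussDensity d h x - gaussDensity d 0 x|
        ≤ ∫ x, (gaussDensity d h x + gaussDensity d 0 x) := by
          refine integral_mono hint.abs
            ((integrable_gaussDensity h).add (integrable_gaussDensity 0)) fun x => ?_
          have := gaussDensity_pos d h x
          have := gaussDensity_pos d 0 x
          simp only
          rw [abs_le]; constructor <;> linarith
      _ = 2 := by
          rw [integral_add (integrable_gaussDensity h) (integrable_gaussDensity 0), h1, h1]; norm_num
      _ ≤ _ := by linarith
  · push Not at hh
    set ρ : E d → ℝ := fun x => Real.exp (inner ℝ h x - ‖h‖ ^ 2 / 2) with hρ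
    have hden x : gaussDensity d h x = gaussDensity d 0 x * ρ x := by
      simp only [gaussDensity, hρ, sub_zero]
      rw [mul_assoc, ← Real.exp_add, norm_sub_sq_real, real_inner_comm h x]
      ring_nf
    have e1 x : ρ x = Real.exp (-(‖h‖ ^ 2 / 2)) * Real.exp (inner ℝ h x) := by
      rw [← Real.exp_add]; simp only [hρ]; ring_nf
    have e2 x : ρ x ^ 2 = Real.exp (-(‖h‖ ^ 2)) * Real.exp (inner ℝ ((2 : ℝ) • h) x) := by
      rw [← Real.exp_add, pow_two, ← Real.exp_add, real_inner_smul_left]; ring_nf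
    have i1 : Integrable ρ (normalLaw (0 : E d)) := by
      simp_rw [funext e1]
      exact (integrable_exp_inner_stdGaussian d h).const_mul _
    have i2 : Integrable (fun x => ρ x ^ 2) (normalLaw (0 : E d)) := by
      simp_rw [e2]
      exact (integrable_exp_inner_stdGaussian d _).const_mul _
    have v1 : ∫ x, ρ x ∂(normalLaw (0 : E d)) = 1 := by
      simp_rw [e1]
      rw [integral_const_mul, integral_exp_inner_stdGaussian, ← Real.exp_add]; simp
    have v2 : ∫ x, ρ x ^ 2 ∂(normalLaw (0 : E d)) = Real.exp (‖h‖ ^ 2) := by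
      simp_rw [e2]
      rw [integral_const_mul, integral_exp_inner_stdGaussian, ← Real.exp_add, norm_smul]
      congr 1; norm_num; ring
    have i3 : Integrable (fun x => (ρ x - 1) ^ 2) (normalLaw (0 : E d)) := by
      have : (fun x => (ρ x - 1) ^ 2) = fun x => ρ x ^ 2 - 2 * ρ x + 1 := by ext x; ring
      rw [this]
      exact (i2.sub (i1.const_mul 2)).add (integrable_const 1)
    have v3 : ∫ x, (ρ x - 1) ^ 2 ∂(normalLaw (0 : E d)) = Real.exp (‖h‖ ^ 2) - 1 := by
      have : (fun x => (ρ x - 1) ^ 2) = fun x => ρ x ^ 2 - 2 * ρ x + 1 := by ext x; ring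
      rw [this, integral_add (f := fun x => ρ x ^ 2 - 2 * ρ x) (i2.sub (i1.const_mul 2))
        (integrable_const 1), integral_sub i2 (i1.const_mul 2), integral_const_mul, v1, v2]
      simp; ring
    have i4 : Integrable (fun x => |ρ x - 1|) (normalLaw (0 : E d)) :=
      (i1.sub (integrable_const 1)).abs
    have e3 : ∫ x, |gaussDensity d h x - gaussDensity d 0 x| =
        ∫ x, |ρ x - 1| ∂(normalLaw (0 : E d)) := by
      rw [integral_normalLaw]
      congr 1
      ext x
      rw [hden, ← abs_of_pos (gaussDensity_pos d 0 x), ← abs_mul,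
        abs_of_pos (gaussDensity_pos d 0 x)]
      ring_nf
    rw [e3]
    have hexp : Real.exp (‖h‖ ^ 2) - 1 ≤ 2 * ‖h‖ ^ 2 := by
      have h0 : 0 ≤ ‖h‖ ^ 2 := by positivity
      have h1' : |‖h‖ ^ 2| ≤ 1 := by
        rw [abs_of_nonneg h0]; exact pow_le_one₀ (norm_nonneg _) hh.le
      have := Real.abs_exp_sub_one_le h1'
      rw [abs_of_nonneg h0] at this
      exact (le_abs_self _).trans this
    rcases eq_or_ne h 0 with rfl | hne
    · simp [hρ]
    have hpos : 0 < ‖h‖ := norm_pos_iff.2 hne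
    -- AM-GM: `|a| ≤ a² / (2 c) + c / 2` with `c = ‖h‖`
    calc ∫ x, |ρ x - 1| ∂(normalLaw (0 : E d))
        ≤ ∫ x, ((ρ x - 1) ^ 2 * (1 / (2 * ‖h‖)) + ‖h‖ / 2) ∂(normalLaw (0 : E d)) := by
          refine integral_mono i4 ((i3.mul_const _).add (integrable_const _)) fun x => ?_
          have : 0 ≤ (|ρ x - 1| - ‖h‖) ^ 2 := sq_nonneg _
          rw [← sq_abs (ρ x - 1)]
          simp only
          rw [mul_one_div, div_add_div _ _ (by positivity) (by norm_num), le_div_iff₀ (by positivity)]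
          nlinarith
      _ = (Real.exp (‖h‖ ^ 2) - 1) * (1 / (2 * ‖h‖)) + ‖h‖ / 2 := by
          rw [integral_add (i3.mul_const _) (integrable_const _), integral_mul_const, v3]; simp
      _ ≤ (2 * ‖h‖ ^ 2) * (1 / (2 * ‖h‖)) + ‖h‖ / 2 := by gcongr
      _ ≤ 2 * ‖h‖ := by
          have : (2 * ‖h‖ ^ 2) * (1 / (2 * ‖h‖)) = ‖h‖ := by field_simp
          linarith

lemma integral_abs_gaussDensity_sub_le' (d : ℕ) (θ θ' : E d) :
    ∫ x, |gaussDensity d θ x - gaussDensity d θ' x| ≤ 2 * ‖θ - θ'‖ := by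
  refine le_trans (le_of_eq ?_) (integral_abs_gaussDensity_sub_le d (θ - θ'))
  rw [← integral_sub_right_eq_self
    (fun x => |gaussDensity d (θ - θ') x - gaussDensity d 0 x|) θ']
  congr 1
  ext x
  simp [gaussDensity]

/-! ### Moments of the uniform distribution on the sphere -/

/-- Off the origin, which is null, polar coordinates carry the volume to the product of the surface
measure and r^(d-1) dr, so an integrand that splits into direction and radius gives a product. -/
lemma integral_polar {d : ℕ} [NeZero d] (H : E d → ℝ) (K : ℝ → ℝ) :
    ∫ z : E d, H (‖z‖⁻¹ • z) * K ‖z‖ =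
      (∫ u : Metric.sphere (0 : E d) 1, H u ∂(volume : Measure (E d)).toSphere) *
        ∫ r in Set.Ioi (0 : ℝ), r ^ (d - 1) * K r := by
  have hd : Module.finrank ℝ (E d) = d := by simp
  calc ∫ z : E d, H (‖z‖⁻¹ • z) * K ‖z‖
      = ∫ z : ({0}ᶜ : Set (E d)), H (‖z.1‖⁻¹ • z.1) * K ‖z.1‖ ∂((volume : Measure (E d)).comap Subtype.val) := by
        rw [integral_subtype_comap (measurableSet_singleton _).compl
          fun z => H (‖z‖⁻¹ • z) * K ‖z‖, restrict_compl_singleton]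
    _ = ∫ p, H p.1 * K p.2 ∂(volume : Measure (E d)).toSphere.prod
          (.volumeIoiPow (Module.finrank ℝ (E d) - 1)) := by
        rw [← (Measure.measurePreserving_homeomorphUnitSphereProd
          (volume : Measure (E d))).integral_comp (Homeomorph.measurableEmbedding _)
            (fun p => H p.1 * K p.2)]
        simp
    _ = (∫ u : Metric.sphere (0 : E d) 1, H u ∂(volume : Measure (E d)).toSphere) *
          ∫ r : Set.Ioi (0 : ℝ), K r ∂(.volumeIoiPow (Module.finrank ℝ (E d) - 1)) :=
        integral_prod_mul (fun u : Metric.sphere (0 : E d) 1 => H u)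
          (fun r : Set.Ioi (0 : ℝ) => K r)
    _ = _ := by
        congr 1
        simp only [Measure.volumeIoiPow, ENNReal.ofReal, hd]
        rw [integral_withDensity_eq_integral_smul
            ((measurable_subtype_coe.pow_const _).real_toNNReal),
          integral_subtype_comap measurableSet_Ioi fun a => Real.toNNReal (a ^ (d - 1)) • K a]
        refine setIntegral_congr_fun measurableSet_Ioi fun x hx => ?_
        rw [NNReal.smul_def, Real.coe_toNNReal _ (pow_nonneg hx.out.le _), smul_eq_mul]

lemma toSphere_univ_pos (d : ℕ) [NeZero d] :
    0 < (volume : Measure (E d)).toSphere.real Set.univ := by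
  rw [measureReal_def]
  exact ENNReal.toReal_pos (Measure.measure_univ_ne_zero.2 (Measure.toSphere_ne_zero _))
    (measure_ne_top _ _)

instance (d : ℕ) [NeZero d] : IsProbabilityMeasure (sphereUniform d) := by
  refine ⟨?_⟩
  rw [sphereUniform, Measure.smul_apply, smul_eq_mul]
  exact ENNReal.inv_mul_cancel (Measure.measure_univ_ne_zero.2 (Measure.toSphere_ne_zero _))
    (measure_ne_top _ _)

lemma integral_sphereUniform {d : ℕ} (G : Metric.sphere (0 : E d) 1 → ℝ) :
    ∫ u, G u ∂(sphereUniform d) = ((volume : Measure (E d)).toSphere.real Set.univ)⁻¹ *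
      ∫ u, G u ∂(volume : Measure (E d)).toSphere := by
  rw [sphereUniform, integral_smul_measure, ENNReal.toReal_inv, smul_eq_mul, measureReal_def]

lemma integral_radial_gauss {d : ℕ} [NeZero d] (k : ℕ) :
    ∫ r in Set.Ioi (0 : ℝ), r ^ (d - 1) * (r ^ k * Real.exp (-r ^ 2 / 2)) =
      2 ^ (((k : ℝ) + d) / 2 - 1) * Real.Gamma (((k : ℝ) + d) / 2) := by
  have hd : 1 ≤ d := NeZero.one_le
  have hd' : (1 : ℝ) ≤ d := by exact_mod_cast hd
  have hk : (0 : ℝ) ≤ k := by positivity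
  have := integral_rpow_mul_exp_neg_mul_rpow (p := 2) (q := (k : ℝ) + d - 1) (b := 1 / 2)
    (by norm_num) (by linarith) (by norm_num)
  rw [show (k : ℝ) + d - 1 + 1 = k + d by ring] at this
  calc _ = ∫ x in Set.Ioi (0 : ℝ), x ^ ((k : ℝ) + d - 1) * Real.exp (-(1 / 2) * x ^ (2 : ℝ)) := by
        refine setIntegral_congr_fun measurableSet_Ioi fun x hx => ?_
        rw [← mul_assoc, ← pow_add, ← Real.rpow_natCast, Nat.cast_add, Nat.cast_sub hd]
        congr 2
        · push_cast; ring
        · rw [show (2 : ℝ) = ((2 : ℕ) : ℝ) by norm_num, Real.rpow_natCast]; push_cast; ring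
    _ = _ := by
        rw [this, one_div, Real.inv_rpow (by norm_num), neg_div, Real.rpow_neg (by norm_num), inv_inv,
          Real.rpow_sub_one (by norm_num)]
        ring

/-- Polar coordinates for the standard Gaussian density. -/
lemma integral_gaussDensity_polar {d : ℕ} [NeZero d] (H : E d → ℝ) (k : ℕ) :
    ∫ z : E d, gaussDensity d 0 z * (H (‖z‖⁻¹ • z) * ‖z‖ ^ k) =
      (∫ u, H u ∂(sphereUniform d)) *
        (2 ^ ((k : ℝ) / 2) * Real.Gamma (((k : ℝ) + d) / 2) / Real.Gamma ((d : ℝ) / 2)) := by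
  set c : ℝ := (2 * Real.pi) ^ (-(d : ℝ) / 2)
  have key (H : E d → ℝ) (k : ℕ) : ∫ z : E d, gaussDensity d 0 z * (H (‖z‖⁻¹ • z) * ‖z‖ ^ k) =
      c * ((∫ u : Metric.sphere (0 : E d) 1, H u ∂(volume : Measure (E d)).toSphere) *
        (2 ^ (((k : ℝ) + d) / 2 - 1) * Real.Gamma (((k : ℝ) + d) / 2))) := by
    rw [← integral_radial_gauss, ← integral_polar H (fun r => r ^ k * Real.exp (-r ^ 2 / 2)),
      ← integral_const_mul]
    congr 1
    ext z
    simp only [gaussDensity, sub_zero, c]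
    ring
  -- The Gaussian has mass one, which fixes the product of the constant `c` and the area of the
  -- sphere; no formula for the area is needed.
  have h0 := key (fun _ => 1) 0
  have h1 : ∫ z, gaussDensity d 0 z = 1 := by
    have := integral_normalLaw (0 : E d) (fun _ => 1)
    simpa using this.symm
  simp only [pow_zero, mul_one, h1, integral_const, smul_eq_mul, CharP.cast_eq_zero,
    zero_add] at h0
  rw [key, integral_sphereUniform]
  have hτ := toSphere_univ_pos d
  have hd : (0 : ℝ) < d := by exact_mod_cast Nat.pos_of_ne_zero (NeZero.ne d)
  have hG : 0 < Real.Gamma ((d : ℝ) / 2) := Real.Gamma_pos_of_pos (by positivity)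
  set τ := (volume : Measure (E d)).toSphere.real Set.univ
  have hc : c = (τ * (2 ^ ((d : ℝ) / 2 - 1) * Real.Gamma ((d : ℝ) / 2)))⁻¹ :=
    eq_inv_of_mul_eq_one_left h0.symm
  have h2 : (2 : ℝ) ^ (((k : ℝ) + d) / 2 - 1) = 2 ^ ((k : ℝ) / 2) * 2 ^ ((d : ℝ) / 2 - 1) := by
    rw [← Real.rpow_add (by norm_num)]; ring_nf
  have h3 : (0 : ℝ) < 2 ^ ((d : ℝ) / 2 - 1) := by positivity
  rw [hc, h2]
  field_simp

lemma stdGaussian_map_inner {d : ℕ} {e : E d} (he : ‖e‖ = 1) :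
    (normalLaw (0 : E d)).map (fun z => inner ℝ e z) = gaussianReal 0 1 := by
  have h : normalLaw (0 : E d) = stdGaussian (E d) := by simp [normalLaw_eq_map]
  have := IsGaussian.map_eq_gaussianReal (μ := stdGaussian (E d)) (innerSL ℝ e)
  rw [variance_dual_stdGaussian, integral_strongDual_stdGaussian] at this
  rw [h]
  convert this using 1
  · rfl
  · rw [innerSL_apply_norm, he]
    simp

lemma integral_pow_even_gaussianReal (m : ℕ) :
    ∫ x, x ^ (2 * m) ∂(gaussianReal 0 1) = 2 ^ m * Real.Gamma (m + 1 / 2) / Real.sqrt Real.pi := by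
  rw [integral_gaussianReal_eq_integral_smul (by norm_num)]
  -- The trivial factor `y ^ (1 - 1)` brings the integrand to the form of `integral_radial_gauss`
  -- with d = 1.
  have h1 : ∫ x : ℝ, gaussianPDFReal 0 1 x • x ^ (2 * m) =
      ∫ x : ℝ, (fun y : ℝ => (Real.sqrt (2 * Real.pi))⁻¹ * (y ^ (1 - 1) *
        (y ^ (2 * m) * Real.exp (-y ^ 2 / 2)))) |x| := by
    congr 1
    ext x
    simp only [gaussianPDFReal, pow_mul, sq_abs]
    simp
    ring
  rw [h1, integral_comp_abs (f := fun y : ℝ => (Real.sqrt (2 * Real.pi))⁻¹ * (y ^ (1 - 1) *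
        (y ^ (2 * m) * Real.exp (-y ^ 2 / 2)))), integral_const_mul, integral_radial_gauss]
  have h2 : (2 : ℝ) ^ ((((2 * m : ℕ) : ℝ) + ((1 : ℕ) : ℝ)) / 2 - 1) = 2 ^ m / Real.sqrt 2 := by
    rw [Real.sqrt_eq_rpow, ← Real.rpow_natCast, ← Real.rpow_sub (by norm_num)]
    push_cast; ring_nf
  rw [h2, Real.sqrt_mul (by norm_num)]
  have h3 : (((2 * m : ℕ) : ℝ) + ((1 : ℕ) : ℝ)) / 2 = m + 1 / 2 := by push_cast; ring
  rw [h3]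
  have h4 : Real.sqrt 2 * Real.sqrt 2 = 2 := Real.mul_self_sqrt (by norm_num)
  have h5 : 0 < Real.sqrt Real.pi := Real.sqrt_pos.2 Real.pi_pos
  have h6 : 0 < Real.sqrt 2 := by positivity
  field_simp
  nlinarith

lemma integral_normalLaw_inner_pow {d : ℕ} [NeZero d] (e : E d) (k : ℕ) :
    ∫ z, (inner ℝ e z) ^ k ∂(normalLaw (0 : E d)) =
      (∫ u : Metric.sphere (0 : E d) 1, (inner ℝ e (u : E d)) ^ k ∂(sphereUniform d)) *
        (2 ^ ((k : ℝ) / 2) * Real.Gamma (((k : ℝ) + d) / 2) / Real.Gamma ((d : ℝ) / 2)) := by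
  rw [integral_normalLaw, ← integral_gaussDensity_polar (fun u => (inner ℝ e u) ^ k)]
  congr 1
  ext z
  rw [← mul_pow, real_inner_smul_right]
  rcases eq_or_ne z 0 with rfl | hz
  · simp
  · have : ‖z‖ ≠ 0 := norm_ne_zero_iff.2 hz
    field_simp

/-- The moment of ⟨e, z⟩ for Gaussian z is one-dimensional, and it is also the sphere moment times a
radial moment; divide. The factor (2m)! is set apart to cancel against the exponential series and
leave a Bessel coefficient. -/
lemma integral_sphere_inner_pow_even {d : ℕ} [NeZero d] {e : E d} (he : ‖e‖ = 1) (m : ℕ) :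
    ∫ u : Metric.sphere (0 : E d) 1, (inner ℝ e (u : E d)) ^ (2 * m) ∂(sphereUniform d) =
      ((2 * m).factorial : ℝ) * (Real.Gamma ((d : ℝ) / 2) /
        (4 ^ m * m.factorial * Real.Gamma (m + (d : ℝ) / 2))) := by
  have h1 := integral_normalLaw_inner_pow e (2 * m)
  have h2 : ∫ z, (inner ℝ e z) ^ (2 * m) ∂(normalLaw (0 : E d)) =
      2 ^ m * Real.Gamma (m + 1 / 2) / Real.sqrt Real.pi := by
    rw [← integral_pow_even_gaussianReal, ← stdGaussian_map_inner he,
      integral_map (by fun_prop) (by fun_prop)]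
  rw [h2] at h1
  have hd : (0 : ℝ) < d := by exact_mod_cast Nat.pos_of_ne_zero (NeZero.ne d)
  have hG : 0 < Real.Gamma ((d : ℝ) / 2) := Real.Gamma_pos_of_pos (by positivity)
  have hG2 : 0 < Real.Gamma (m + (d : ℝ) / 2) := Real.Gamma_pos_of_pos (by positivity)
  have h3 : (((2 * m : ℕ) : ℝ) + d) / 2 = m + (d : ℝ) / 2 := by push_cast; ring
  have h4 : (2 : ℝ) ^ (((2 * m : ℕ) : ℝ) / 2) = 2 ^ m := by
    rw [← Real.rpow_natCast]; push_cast; ring_nf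
  rw [h3, h4] at h1
  -- Legendre's duplication formula at m + 1/2.
  have h5 : Real.Gamma (m + 1 / 2) / Real.sqrt Real.pi * (4 ^ m * m.factorial) =
      ((2 * m).factorial : ℝ) := by
    have := Real.Gamma_mul_Gamma_add_half ((m : ℝ) + 1 / 2)
    rw [show (m : ℝ) + 1 / 2 + 1 / 2 = m + 1 by ring, Real.Gamma_nat_eq_factorial,
      show 2 * ((m : ℝ) + 1 / 2) = ((2 * m : ℕ) : ℝ) + 1 by push_cast; ring,
      Real.Gamma_nat_eq_factorial, show 1 - (((2 * m : ℕ) : ℝ) + 1) = -((2 * m : ℕ) : ℝ) by ring,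
      Real.rpow_neg (by norm_num), Real.rpow_natCast, pow_mul] at this
    have hs : 0 < Real.sqrt Real.pi := Real.sqrt_pos.2 Real.pi_pos
    rw [div_mul_eq_mul_div, div_eq_iff hs.ne', mul_left_comm, this]
    field_simp
    norm_num
  rw [← h5]
  field_simp
  field_simp at h1
  linarith

lemma integral_sphere_inner_pow_odd {d : ℕ} [NeZero d] (e : E d) (m : ℕ) :
    ∫ u : Metric.sphere (0 : E d) 1, (inner ℝ e (u : E d)) ^ (2 * m + 1) ∂(sphereUniform d) = 0 := by
  have h1 := integral_normalLaw_inner_pow e (2 * m + 1)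
  have h2 : ∫ z, (inner ℝ e z) ^ (2 * m + 1) ∂(normalLaw (0 : E d)) = 0 := by
    rw [integral_normalLaw]
    have := integral_neg_eq_self (fun z : E d => gaussDensity d 0 z * (inner ℝ e z) ^ (2 * m + 1))
      volume
    simp only [gaussDensity, inner_neg_right, sub_zero, norm_neg, (odd_two_mul_add_one m).neg_pow,
      mul_neg, integral_neg] at this ⊢
    linarith
  rw [h2] at h1
  have hd : (0 : ℝ) < d := by exact_mod_cast Nat.pos_of_ne_zero (NeZero.ne d)
  have hG : 0 < Real.Gamma ((d : ℝ) / 2) := Real.Gamma_pos_of_pos (by positivity)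
  have hG2 : 0 < Real.Gamma ((((2 * m + 1 : ℕ) : ℝ) + d) / 2) :=
    Real.Gamma_pos_of_pos (by positivity)
  refine (mul_eq_zero.1 h1.symm).resolve_right ?_
  positivity

/-! ### Exponential integrals over the sphere and Bessel functions -/

lemma abs_inner_sphere_le {d : ℕ} {e : E d} (he : ‖e‖ = 1) (u : Metric.sphere (0 : E d) 1) :
    |inner ℝ e (u : E d)| ≤ 1 := by
  have := abs_real_inner_le_norm e (u : E d)
  simpa [he] using this

/-- Termwise integration of the exponential series, dominated by |s|^k / k!. The cases l = 0 and l =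
1 give the normalization and the mean of the posterior on a sphere. -/
lemma hasSum_integral_sphere_exp {d : ℕ} [NeZero d] {e : E d} (he : ‖e‖ = 1) (s : ℝ) (l : ℕ) :
    HasSum (fun k : ℕ => ∫ u : Metric.sphere (0 : E d) 1,
        s ^ k * (inner ℝ e (u : E d)) ^ (k + l) / (k.factorial : ℝ) ∂(sphereUniform d))
      (∫ u : Metric.sphere (0 : E d) 1,
        (inner ℝ e (u : E d)) ^ l * Real.exp (s * inner ℝ e (u : E d)) ∂(sphereUniform d)) := by
  refine hasSum_integral_of_dominated_convergence (fun k _ => |s| ^ k / (k.factorial : ℝ))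
    (fun k => ?_) (fun k => .of_forall fun u => ?_) (.of_forall fun u => ?_) ?_
    (.of_forall fun u => ?_)
  · exact (by fun_prop : Continuous fun u : Metric.sphere (0 : E d) 1 =>
      s ^ k * (inner ℝ e (u : E d)) ^ (k + l) / (k.factorial : ℝ)).aestronglyMeasurable
  · rw [Real.norm_eq_abs, abs_div, abs_mul, abs_pow, abs_pow, Nat.abs_cast]
    gcongr
    exact mul_le_of_le_one_right (by positivity)
      (pow_le_one₀ (abs_nonneg _) (abs_inner_sphere_le he u))
  · exact Real.summable_pow_div_factorial _
  · exact integrable_const _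
  · have := (NormedSpace.expSeries_div_hasSum_exp (𝔸 := ℝ) (s * inner ℝ e (u : E d))).mul_left
      ((inner ℝ e (u : E d)) ^ l)
    rw [← Real.exp_eq_exp_ℝ] at this
    refine this.congr_fun ?_
    intro k
    rw [mul_pow, pow_add]
    ring

lemma besselI_eq_mul_tsum (ν : ℝ) {x : ℝ} (hx : 0 < x) :
    besselI ν x = (x / 2) ^ ν *
      ∑' m : ℕ, (x / 2) ^ (2 * m) / ((m.factorial : ℝ) * Real.Gamma ((m : ℝ) + ν + 1)) := by
  rw [besselI, ← tsum_mul_left]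
  congr 1
  ext m
  rw [add_comm (2 * (m : ℝ)) ν, Real.rpow_add (by positivity), ← mul_div_assoc]
  congr 2
  rw [← Real.rpow_natCast]
  push_cast
  rfl

/-- The odd moments vanish, and the even ones turn the exponential series into the Bessel series of
order d/2 - 1. With one more factor ⟨e, u⟩ the odd powers of s survive instead and the order rises
to d/2. -/
lemma integral_sphere_exp {d : ℕ} [NeZero d] {e : E d} (he : ‖e‖ = 1) {s : ℝ} (hs : 0 < s) :
    ∫ u : Metric.sphere (0 : E d) 1, Real.exp (s * inner ℝ e (u : E d)) ∂(sphereUniform d) =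
      Real.Gamma ((d : ℝ) / 2) * (s / 2) ^ (1 - (d : ℝ) / 2) * besselI ((d : ℝ) / 2 - 1) s := by
  have h := hasSum_integral_sphere_exp he s 0
  have hinj : Function.Injective (fun m : ℕ => 2 * m) := fun a b h => by simpa using h
  rw [← hinj.hasSum_iff] at h
  · rw [besselI_eq_mul_tsum _ hs, mul_assoc, ← mul_assoc ((s / 2) ^ (1 - (d : ℝ) / 2)),
      ← Real.rpow_add (by positivity), show 1 - (d : ℝ) / 2 + ((d : ℝ) / 2 - 1) = 0 by ring,
      Real.rpow_zero, one_mul, ← tsum_mul_left]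
    simp only [pow_zero, one_mul] at h
    rw [← h.tsum_eq]
    congr 1
    ext m
    simp only [Function.comp_apply, add_zero, mul_div_assoc]
    rw [integral_const_mul, integral_div, integral_sphere_inner_pow_even he,
      show (m : ℝ) + ((d : ℝ) / 2 - 1) + 1 = m + (d : ℝ) / 2 by ring]
    have : ((2 * m).factorial : ℝ) ≠ 0 := by positivity
    rw [div_pow, pow_mul 2]
    field_simp
    norm_num
  · intro k hk
    have hodd : Odd k := by
      rw [← Nat.not_even_iff_odd]
      rintro ⟨j, rfl⟩
      exact hk ⟨j, by simp only; ring⟩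
    obtain ⟨j, rfl⟩ := hodd
    simp only [add_zero, mul_div_assoc]
    rw [integral_const_mul, integral_div, integral_sphere_inner_pow_odd]
    simp

lemma integral_sphere_inner_mul_exp {d : ℕ} [NeZero d] {e : E d} (he : ‖e‖ = 1) {s : ℝ}
    (hs : 0 < s) :
    ∫ u : Metric.sphere (0 : E d) 1, inner ℝ e (u : E d) * Real.exp (s * inner ℝ e (u : E d))
      ∂(sphereUniform d) =
      Real.Gamma ((d : ℝ) / 2) * (s / 2) ^ (1 - (d : ℝ) / 2) * besselI ((d : ℝ) / 2) s := by
  have h := hasSum_integral_sphere_exp he s 1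
  have hinj : Function.Injective (fun m : ℕ => 2 * m + 1) := fun a b h => by simpa using h
  rw [← hinj.hasSum_iff] at h
  · rw [besselI_eq_mul_tsum _ hs, mul_assoc, ← mul_assoc ((s / 2) ^ (1 - (d : ℝ) / 2)),
      ← Real.rpow_add (by positivity), show 1 - (d : ℝ) / 2 + (d : ℝ) / 2 = 1 by ring,
      Real.rpow_one, ← tsum_mul_left, ← tsum_mul_left]
    simp only [pow_one] at h
    rw [← h.tsum_eq]
    congr 1
    ext m
    simp only [Function.comp_apply, mul_div_assoc]
    have hd : (0 : ℝ) < d := by exact_mod_cast Nat.pos_of_ne_zero (NeZero.ne d)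
    have hG2 : 0 < Real.Gamma ((m : ℝ) + 1 + (d : ℝ) / 2) := Real.Gamma_pos_of_pos (by positivity)
    rw [integral_const_mul, integral_div, show 2 * m + 1 + 1 = 2 * (m + 1) by ring,
      integral_sphere_inner_pow_even he, show (m : ℝ) + (d : ℝ) / 2 + 1 = m + 1 + (d : ℝ) / 2 by ring,
      show 2 * (m + 1) = (2 * m + 1) + 1 by ring, Nat.factorial_succ (2 * m + 1),
      Nat.factorial_succ m]
    have : ((2 * m + 1).factorial : ℝ) ≠ 0 := by positivity
    push_cast
    rw [div_pow, pow_mul 2]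
    field_simp
    norm_num
    ring
  · intro k hk
    have heven : Even k := by
      rw [← Nat.not_odd_iff_even]
      rintro ⟨j, rfl⟩
      exact hk ⟨j, rfl⟩
    obtain ⟨j, rfl⟩ := heven
    simp only [← two_mul, mul_div_assoc]
    rw [integral_const_mul, integral_div, integral_sphere_inner_pow_odd]
    simp

/-- The uniform distribution on the sphere is invariant under linear isometries. -/
lemma integral_sphere_comp_isometry {d : ℕ} [NeZero d] (Q : E d ≃ₗᵢ[ℝ] E d) (H : E d → ℝ) :
    ∫ u : Metric.sphere (0 : E d) 1, H (Q u) ∂(sphereUniform d) =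
      ∫ u : Metric.sphere (0 : E d) 1, H u ∂(sphereUniform d) := by
  have hd : (0 : ℝ) < d := by exact_mod_cast Nat.pos_of_ne_zero (NeZero.ne d)
  have hG : 0 < Real.Gamma ((d : ℝ) / 2) := Real.Gamma_pos_of_pos (by positivity)
  have key (H : E d → ℝ) : ∫ z : E d, gaussDensity d 0 z * H (‖z‖⁻¹ • z) =
      ∫ u, H u ∂(sphereUniform d) := by
    have := integral_gaussDensity_polar H 0
    simpa [hG.ne'] using this
  rw [← key (fun u => H (Q u)), ← key, ← Q.measurePreserving.integral_comp
    Q.toHomeomorph.measurableEmbedding (fun z => gaussDensity d 0 z * H (‖z‖⁻¹ • z))]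
  simp [gaussDensity]

/-- The reflection in the hyperplane orthogonal to `w` fixes `e`, preserves the uniform law and
changes the sign of the integrand. -/
lemma integral_sphere_inner_orthogonal_mul_exp {d : ℕ} [NeZero d] {e w : E d}
    (h : inner ℝ e w = 0) (s : ℝ) :
    ∫ u : Metric.sphere (0 : E d) 1, inner ℝ w (u : E d) * Real.exp (s * inner ℝ e (u : E d))
      ∂(sphereUniform d) = 0 := by
  have h1 := integral_sphere_comp_isometry ((ℝ ∙ w)ᗮ.reflection)
    (fun u => inner ℝ w (u : E d) * Real.exp (s * inner ℝ e (u : E d)))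
  have hw u : inner ℝ w ((ℝ ∙ w)ᗮ.reflection u) = - inner ℝ w u := by
    rw [← LinearIsometryEquiv.inner_map_map (ℝ ∙ w)ᗮ.reflection, Submodule.reflection_reflection,
      Submodule.reflection_orthogonalComplement_singleton_eq_neg, inner_neg_left]
  have he u : inner ℝ e ((ℝ ∙ w)ᗮ.reflection u) = inner ℝ e u := by
    have : (ℝ ∙ w)ᗮ.reflection e = e := by
      rw [Submodule.reflection_eq_self_iff, Submodule.mem_orthogonal_singleton_iff_inner_left]
      exact h
    conv_lhs => rw [← this]
    rw [LinearIsometryEquiv.inner_map_map]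
  simp only [hw, he, neg_mul, integral_neg] at h1
  linarith

lemma integrable_sphere_of_continuous {d : ℕ} [NeZero d] {F : Type*} [NormedAddCommGroup F]
    {g : E d → F} (hg : Continuous g) :
    Integrable (fun u : Metric.sphere (0 : E d) 1 => g u) (sphereUniform d) := by
  have hc : Continuous fun u : Metric.sphere (0 : E d) 1 => g u := hg.comp continuous_subtype_val
  rw [← integrableOn_univ]
  exact hc.continuousOn.integrableOn_compact isCompact_univ

lemma integral_sphere_exp_smul {d : ℕ} [NeZero d] {e : E d} (he : ‖e‖ = 1) {s : ℝ} (hs : 0 < s) :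
    ∫ u : Metric.sphere (0 : E d) 1, Real.exp (s * inner ℝ e (u : E d)) • (u : E d)
      ∂(sphereUniform d) =
      (Real.Gamma ((d : ℝ) / 2) * (s / 2) ^ (1 - (d : ℝ) / 2) * besselI ((d : ℝ) / 2) s) • e := by
  refine ext_inner_left ℝ fun v => ?_
  rw [← integral_inner (integrable_sphere_of_continuous
    (g := fun u => Real.exp (s * inner ℝ e u) • u) (by fun_prop)), inner_smul_right,
    ← integral_sphere_inner_mul_exp he hs]
  set w := v - (inner ℝ v e : ℝ) • e with hw
  have hew : inner ℝ e w = 0 := by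
    rw [hw, inner_sub_right, inner_smul_right, real_inner_self_eq_norm_sq, he, real_inner_comm]
    ring
  have h2 (u : E d) : inner ℝ v (Real.exp (s * inner ℝ e u) • u) =
      inner ℝ v e * (inner ℝ e u * Real.exp (s * inner ℝ e u)) +
        inner ℝ w u * Real.exp (s * inner ℝ e u) := by
    rw [hw, inner_sub_left, inner_smul_right, inner_smul_left]
    simp
    ring
  simp_rw [h2]
  rw [integral_add, integral_const_mul, integral_sphere_inner_orthogonal_mul_exp hew]
  · ring
  · exact integrable_sphere_of_continuous
      (g := fun u => inner ℝ v e * (inner ℝ e u * Real.exp (s * inner ℝ e u))) (by fun_prop)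
  · exact integrable_sphere_of_continuous
      (g := fun u => inner ℝ w u * Real.exp (s * inner ℝ e u)) (by fun_prop)

lemma besselI_pos {d : ℕ} [NeZero d] {s : ℝ} (hs : 0 < s) : 0 < besselI ((d : ℝ) / 2 - 1) s := by
  have hd : (0 : ℝ) < d := by exact_mod_cast Nat.pos_of_ne_zero (NeZero.ne d)
  have hG : 0 < Real.Gamma ((d : ℝ) / 2) := Real.Gamma_pos_of_pos (by positivity)
  have he : ‖e₁ d‖ = 1 := by simp [e₁]
  have h := integral_sphere_exp he hs
  have hp : 0 < ∫ u : Metric.sphere (0 : E d) 1, Real.exp (s * inner ℝ (e₁ d) (u : E d))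
      ∂(sphereUniform d) :=
    integral_exp_pos (integrable_sphere_of_continuous
      (g := fun u => Real.exp (s * inner ℝ (e₁ d) u)) (by fun_prop))
  rw [h] at hp
  have h3 : 0 < Real.Gamma ((d : ℝ) / 2) * (s / 2) ^ (1 - (d : ℝ) / 2) := by positivity
  exact (mul_pos_iff_of_pos_left h3).1 hp

/-! ### Mixtures of uniform distributions on spheres -/

lemma lintegral_radialExtension {d : ℕ} [NeZero d] (μ : Measure ℝ) [SFinite μ] {g : E d → ℝ≥0∞}
    (hg : Measurable g) :
    ∫⁻ θ, g θ ∂(radialExtension d μ) = ∫⁻ b, ∫⁻ u, g (b • (u : E d)) ∂(sphereUniform d) ∂μ := by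
  have hm : Measurable fun p : ℝ × Metric.sphere (0 : E d) 1 => p.1 • (p.2 : E d) := by fun_prop
  rw [radialExtension, lintegral_map hg hm, lintegral_prod (fun p : ℝ × Metric.sphere (0 : E d) 1 => g (p.1 • (p.2 : E d)))
      (hg.comp hm).aemeasurable]

lemma lintegral_empirical {N : ℕ} (b : Fin N → ℝ) (g : ℝ → ℝ≥0∞) :
    ∫⁻ x, g x ∂(empirical b) = (N : ℝ≥0∞)⁻¹ * ∑ i, g (b i) := by
  simp [empirical, lintegral_smul_measure, lintegral_finsetSum_measure]

instance {N : ℕ} [NeZero N] (b : Fin N → ℝ) : IsProbabilityMeasure (empirical b) := by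
  refine ⟨?_⟩
  have hN : (N : ℝ≥0∞) ≠ 0 := by exact_mod_cast NeZero.ne N
  simp [empirical, ENNReal.inv_mul_cancel hN]

lemma radialExtension_empirical {d N : ℕ} [NeZero d] [NeZero N] (b : Fin N → ℝ) :
    radialExtension d (empirical b) =
      (N : ℝ≥0∞)⁻¹ • ∑ i, (sphereUniform d).map fun u : Metric.sphere (0 : E d) 1 => b i • (u : E d) := by
  refine Measure.ext_of_lintegral _ fun g hg => ?_
  rw [lintegral_radialExtension _ hg, lintegral_empirical, lintegral_smul_measure,
    lintegral_finsetSum_measure, smul_eq_mul]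
  congr 2
  ext i
  rw [lintegral_map hg (by fun_prop)]

lemma integral_radialExtension_empirical {d N : ℕ} [NeZero d] [NeZero N] (b : Fin N → ℝ)
    {F : Type*} [NormedAddCommGroup F] [NormedSpace ℝ F] {g : E d → F} (hg : Continuous g)
    [SecondCountableTopologyEither (E d) F] :
    ∫ θ, g θ ∂(radialExtension d (empirical b)) =
      (N : ℝ)⁻¹ • ∑ i, ∫ u : Metric.sphere (0 : E d) 1, g (b i • (u : E d)) ∂(sphereUniform d) := by
  have hm (i) : Measurable fun u : Metric.sphere (0 : E d) 1 => b i • (u : E d) := by fun_prop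
  rw [radialExtension_empirical, integral_smul_measure, integral_finsetSum_measure]
  · simp only [ENNReal.toReal_inv, ENNReal.toReal_natCast]
    congr 2
    ext i
    rw [integral_map (hm i).aemeasurable hg.aestronglyMeasurable]
  · intro i _
    rw [integrable_map_measure hg.aestronglyMeasurable (hm i).aemeasurable]
    exact integrable_sphere_of_continuous (g := fun u => g (b i • u)) (by fun_prop)

/-! ### The minimization oracle computes posterior means -/

/-- The unnormalized posterior distribution of the parameter given the observation `x`. -/
def posterior {d : ℕ} (π : Measure (E d)) (x : E d) : Measure (E d) :=
  π.withDensity fun θ => ENNReal.ofReal (gaussDensity d θ x)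

/-- The posterior mean. -/
def posteriorMean {d : ℕ} (π : Measure (E d)) (x : E d) : E d := ⨍ θ, θ ∂(posterior π x)

lemma measurable_gaussDensity_left (d : ℕ) (x : E d) : Measurable fun θ => gaussDensity d θ x :=
  ((continuous_gaussDensity d).comp (Continuous.prodMk_left x)).measurable

lemma gaussDensity_le (d : ℕ) (θ x : E d) : gaussDensity d θ x ≤ (2 * Real.pi) ^ (-(d : ℝ) / 2) := by
  unfold gaussDensity
  refine mul_le_of_le_one_right (by positivity) (Real.exp_le_one_iff.2 ?_)
  have : 0 ≤ ‖x - θ‖ ^ 2 := by positivity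
  linarith

instance {d : ℕ} (π : Measure (E d)) [IsFiniteMeasure π] (x : E d) :
    IsFiniteMeasure (posterior π x) := by
  refine isFiniteMeasure_withDensity_ofReal (Integrable.of_bound
    (measurable_gaussDensity_left d x).aestronglyMeasurable ((2 * Real.pi) ^ (-(d : ℝ) / 2))
      (.of_forall fun θ => ?_)).2
  rw [Real.norm_of_nonneg (gaussDensity_pos d θ x).le]
  exact gaussDensity_le d θ x

lemma posteriorMean_eq {d : ℕ} (π : Measure (E d)) (x : E d) :
    posteriorMean π x =
      (∫ θ, gaussDensity d θ x ∂π)⁻¹ • ∫ θ, gaussDensity d θ x • θ ∂π := by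
  have h (F : Type) [NormedAddCommGroup F] [NormedSpace ℝ F] (g : E d → F) :
      ∫ θ, g θ ∂(posterior π x) = ∫ θ, gaussDensity d θ x • g θ ∂π := by
    rw [posterior, integral_withDensity_eq_integral_toReal_smul
      (measurable_gaussDensity_left d x).ennreal_ofReal (by simp)]
    congr 1
    ext θ
    rw [ENNReal.toReal_ofReal (gaussDensity_pos _ _ _).le]
  rw [posteriorMean, average_eq, h]
  congr 2
  have := h ℝ (fun _ => 1)
  simpa using this

lemma norm_posteriorMean_le {d : ℕ} (π : Measure (E d)) [IsFiniteMeasure π] {B : ℝ} (hB : 0 ≤ B)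
    (hπ : ∀ᵐ θ ∂π, ‖θ‖ ≤ B) (x : E d) : ‖posteriorMean π x‖ ≤ B := by
  have h : ∀ᵐ θ ∂(posterior π x), ‖θ‖ ≤ B := (withDensity_absolutelyContinuous _ _).ae_le hπ
  have h1 := norm_integral_le_of_norm_le_const h
  rw [posteriorMean, average_eq, norm_smul, norm_inv, Real.norm_of_nonneg measureReal_nonneg]
  rcases (measureReal_nonneg (μ := posterior π x) (s := Set.univ)).eq_or_lt with h0 | h0
  · rw [← h0]; simpa using hB
  · rw [inv_mul_le_iff₀ h0]; linarith

lemma measurable_posteriorMean {d : ℕ} (π : Measure (E d)) [SFinite π] :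
    Measurable (posteriorMean π) := by
  have h1 : Measurable fun x : E d => ∫ θ, gaussDensity d θ x ∂π :=
    (StronglyMeasurable.integral_prod_right' (ν := π)
      (f := fun p : E d × E d => gaussDensity d p.2 p.1)
      ((continuous_gaussDensity d).comp continuous_swap).stronglyMeasurable).measurable
  have h2 : Measurable fun x : E d => ∫ θ, gaussDensity d θ x • θ ∂π :=
    (StronglyMeasurable.integral_prod_right' (ν := π)
      (f := fun p : E d × E d => gaussDensity d p.2 p.1 • p.2)
      (((continuous_gaussDensity d).comp continuous_swap).smul
        continuous_snd).stronglyMeasurable).measurable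
  have : posteriorMean π = fun x => (∫ θ, gaussDensity d θ x ∂π)⁻¹ •
      ∫ θ, gaussDensity d θ x • θ ∂π := funext fun x => posteriorMean_eq π x
  rw [this]
  exact h1.inv.smul h2

lemma minOracle_zero {d N : ℕ} (b : Fin N → ℝ) : minOracle b (0 : E d) = 0 := by
  simp [minOracle]

lemma gaussDensity_smul_sphere {d : ℕ} {e : E d} (he : ‖e‖ = 1) (r b : ℝ)
    (u : Metric.sphere (0 : E d) 1) : gaussDensity d (b • (u : E d)) (r • e) =
      (2 * Real.pi) ^ (-(d : ℝ) / 2) * Real.exp (-r ^ 2 / 2) * Real.exp (-b ^ 2 / 2) *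
        Real.exp (b * r * inner ℝ e (u : E d)) := by
  have hu : ‖(u : E d)‖ = 1 := by simp
  have h1 : ‖r • e - b • (u : E d)‖ ^ 2 = r ^ 2 - 2 * (b * r * inner ℝ e (u : E d)) + b ^ 2 := by
    rw [norm_sub_sq_real, norm_smul, norm_smul, hu, he, mul_one, mul_one, Real.norm_eq_abs,
      Real.norm_eq_abs, sq_abs, sq_abs, inner_smul_right, real_inner_smul_left]
    ring
  have h2 : Real.exp (-‖r • e - b • (u : E d)‖ ^ 2 / 2) = Real.exp (-r ^ 2 / 2) *
      Real.exp (-b ^ 2 / 2) * Real.exp (b * r * inner ℝ e (u : E d)) := by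
    rw [h1, ← Real.exp_add, ← Real.exp_add]
    congr 1
    ring
  rw [gaussDensity, h2]
  ring

/-- The factor that relates the weights of the minimization oracle to sphere averages of the
Gaussian density. -/
def weightScale (d : ℕ) (r : ℝ) : ℝ :=
  (2 * Real.pi) ^ (-(d : ℝ) / 2) * Real.exp (-r ^ 2 / 2) *
    Real.Gamma ((d : ℝ) / 2) * (r / 2) ^ (1 - (d : ℝ) / 2)

lemma weightScale_pos (d : ℕ) [NeZero d] {r : ℝ} (hr : 0 < r) : 0 < weightScale d r := by
  have hd : (0 : ℝ) < d := by exact_mod_cast Nat.pos_of_ne_zero (NeZero.ne d)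
  have hG : 0 < Real.Gamma ((d : ℝ) / 2) := Real.Gamma_pos_of_pos (by positivity)
  unfold weightScale
  positivity

lemma integral_gaussDensity_sphere {d : ℕ} [NeZero d] {e : E d} (he : ‖e‖ = 1) {r b : ℝ}
    (hr : 0 < r) (hb : 0 < b) :
    ∫ u : Metric.sphere (0 : E d) 1, gaussDensity d (b • (u : E d)) (r • e) ∂(sphereUniform d) =
      weightScale d r * weight d b r := by
  have hsplit : (b * r / 2) ^ (1 - (d : ℝ) / 2) =
      b ^ (1 - (d : ℝ) / 2) * (r / 2) ^ (1 - (d : ℝ) / 2) := by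
    rw [mul_div_assoc, Real.mul_rpow hb.le (by positivity)]
  simp_rw [gaussDensity_smul_sphere he]
  rw [integral_const_mul, integral_sphere_exp he (mul_pos hb hr), hsplit, weight, weightScale]
  ring

lemma integral_gaussDensity_smul_sphere {d : ℕ} [NeZero d] {e : E d} (he : ‖e‖ = 1) {r b : ℝ}
    (hr : 0 < r) (hb : 0 < b) :
    ∫ u : Metric.sphere (0 : E d) 1, gaussDensity d (b • (u : E d)) (r • e) • (b • (u : E d))
      ∂(sphereUniform d) =
      (weightScale d r * (weight d b r * (b * besselRatio d (b * r)))) • e := by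
  have hsplit : (b * r / 2) ^ (1 - (d : ℝ) / 2) =
      b ^ (1 - (d : ℝ) / 2) * (r / 2) ^ (1 - (d : ℝ) / 2) := by
    rw [mul_div_assoc, Real.mul_rpow hb.le (by positivity)]
  have h3 (u : Metric.sphere (0 : E d) 1) :
      gaussDensity d (b • (u : E d)) (r • e) • (b • (u : E d)) =
      ((2 * Real.pi) ^ (-(d : ℝ) / 2) * Real.exp (-r ^ 2 / 2) * Real.exp (-b ^ 2 / 2) * b) •
        (Real.exp (b * r * inner ℝ e (u : E d)) • (u : E d)) := by
    rw [gaussDensity_smul_sphere he, smul_smul, smul_smul]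
    congr 1
    ring
  simp_rw [h3]
  rw [integral_smul, integral_sphere_exp_smul he (mul_pos hb hr), smul_smul, hsplit, weight,
    weightScale, besselRatio]
  have := (besselI_pos (d := d) (mul_pos hb hr)).ne'
  generalize besselI ((d : ℝ) / 2 - 1) (b * r) = I₀ at *
  congr 1
  field_simp

/-- With x = r e, each sphere contributes `weightScale d r` times its weight to the denominator of
the posterior mean, and the same times b A(b r) along e to the numerator. The scale does not depend
on b, so it cancels. The origin, where x has no direction, is a null set. -/
lemma minOracle_eq_posteriorMean {d N : ℕ} [NeZero d] [NeZero N] {b : Fin N → ℝ}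
    (hb : ∀ i, 0 < b i) {x : E d} (hx : x ≠ 0) :
    minOracle b x = posteriorMean (radialExtension d (empirical b)) x := by
  obtain ⟨r, e, hr, he, rfl⟩ : ∃ (r : ℝ) (e : E d), 0 < r ∧ ‖e‖ = 1 ∧ x = r • e := by
    have hx' := norm_pos_iff.2 hx
    refine ⟨‖x‖, ‖x‖⁻¹ • x, hx', ?_, ?_⟩
    · rw [norm_smul, norm_inv, norm_norm, inv_mul_cancel₀ hx'.ne']
    · rw [smul_smul, mul_inv_cancel₀ hx'.ne', one_smul]
  have hN : (N : ℝ) ≠ 0 := by exact_mod_cast NeZero.ne N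
  have hκ := (weightScale_pos d hr).ne'
  have hn : ‖r • e‖ = r := by rw [norm_smul, he, mul_one, Real.norm_of_nonneg hr.le]
  have hc : Continuous fun θ : E d => gaussDensity d θ (r • e) := by unfold gaussDensity; fun_prop
  have h1 := integral_radialExtension_empirical b hc
  have h2 := integral_radialExtension_empirical b (hc.smul continuous_id')
  simp only [Pi.smul_apply'] at h2
  rw [posteriorMean_eq, h1, h2]
  simp_rw [fun i => integral_gaussDensity_sphere he hr (hb i),
    fun i => integral_gaussDensity_smul_sphere he hr (hb i)]
  rw [← Finset.mul_sum, ← Finset.sum_smul, ← Finset.mul_sum, smul_smul, smul_smul, smul_eq_mul,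
    minOracle, hn, inv_smul_smul₀ hr.ne']
  congr 1
  generalize ∑ i, weight d (b i) r * (b i * besselRatio d (b i * r)) = S
  generalize ∑ i, weight d (b i) r = W
  rw [mul_inv, mul_inv, inv_inv]
  field_simp

lemma radialExtension_ae_norm_le {d N : ℕ} [NeZero d] [NeZero N] {b : Fin N → ℝ} {B : ℝ}
    (hb : ∀ i, |b i| ≤ B) : ∀ᵐ θ ∂(radialExtension d (empirical b)), ‖θ‖ ≤ B := by
  have hs : MeasurableSet {θ : E d | ¬ ‖θ‖ ≤ B} := by measurability
  rw [ae_iff, radialExtension_empirical]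
  simp only [Measure.smul_apply, Measure.finsetSum_apply, smul_eq_mul, mul_eq_zero,
    Finset.sum_eq_zero_iff, Finset.mem_univ, true_implies]
  right
  intro i
  rw [Measure.map_apply (by fun_prop) hs]
  convert measure_empty (μ := sphereUniform d)
  ext u
  simp [norm_smul, hb i]

lemma isProbabilityMeasure_radialExtension {d : ℕ} [NeZero d] (μ : Measure ℝ)
    [IsProbabilityMeasure μ] : IsProbabilityMeasure (radialExtension d μ) :=
  Measure.isProbabilityMeasure_map (Measurable.aemeasurable (by fun_prop))

instance {d N : ℕ} [NeZero d] [NeZero N] (b : Fin N → ℝ) :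
    IsProbabilityMeasure (radialExtension d (empirical b)) :=
  isProbabilityMeasure_radialExtension _

lemma minOracle_mem_detEstimators {d N : ℕ} [NeZero d] [NeZero N] {b : Fin N → ℝ} {B : ℝ}
    (hb : ∀ i, 0 < b i) (hB : ∀ i, b i ≤ B) : (minOracle b : E d → E d) ∈ detEstimators d B := by
  have hB0 : 0 ≤ B := (hb 0).le.trans (hB 0)
  have heq : (minOracle b : E d → E d) =
      fun x => if x = 0 then 0 else posteriorMean (radialExtension d (empirical b)) x := by
    ext1 x
    split_ifs with h
    · rw [h, minOracle_zero]
    · exact minOracle_eq_posteriorMean hb h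
  have hae := radialExtension_ae_norm_le (d := d) (b := b) (B := B)
    fun i => by rw [abs_of_pos (hb i)]; exact hB i
  rw [heq]
  refine ⟨Measurable.ite (measurableSet_singleton _) measurable_const
    (measurable_posteriorMean _), fun x => ?_⟩
  simp only [paramSpace, mem_closedBall_zero_iff]
  split_ifs
  · simpa using hB0
  · exact norm_posteriorMean_le _ hB0 hae x

/-- The linear isometries commute with the minimization oracle. -/
lemma minOracle_map_isometry {d N : ℕ} (b : Fin N → ℝ) (Q : E d ≃ₗᵢ[ℝ] E d) (x : E d) :
    minOracle b (Q x) = Q (minOracle b x) := by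
  simp [minOracle]

/-! ### Bayes optimality of the minimization oracle -/

lemma lintegral_normalLaw {d : ℕ} (θ : E d) {g : E d → ℝ≥0∞} (hg : Measurable g) :
    ∫⁻ x, g x ∂(normalLaw θ) = ∫⁻ x, ENNReal.ofReal (gaussDensity d θ x) * g x := by
  rw [normalLaw_eq_withDensity, lintegral_withDensity_eq_lintegral_mul _
    (measurable_gaussDensity d θ).ennreal_ofReal hg]
  rfl

lemma integratedRisk_eq_lintegral_posterior {d : ℕ} {f : E d → E d} (hf : Measurable f)
    (π : Measure (E d)) [SFinite π] :
    integratedRisk f π = ∫⁻ x, ∫⁻ θ, ENNReal.ofReal (‖f x - θ‖ ^ 2) ∂(posterior π x) := by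
  have hm : Measurable fun p : E d × E d =>
      ENNReal.ofReal (gaussDensity d p.1 p.2) * ENNReal.ofReal (‖f p.2 - p.1‖ ^ 2) :=
    (continuous_gaussDensity d).measurable.ennreal_ofReal.mul
      (Measurable.ennreal_ofReal (by fun_prop))
  calc integratedRisk f π = ∫⁻ θ, ∫⁻ x, ENNReal.ofReal (gaussDensity d θ x) *
        ENNReal.ofReal (‖f x - θ‖ ^ 2) ∂volume ∂π := by
        refine lintegral_congr fun θ => ?_
        rw [risk, lintegral_normalLaw θ (Measurable.ennreal_ofReal (by fun_prop))]
    _ = ∫⁻ x, ∫⁻ θ, ENNReal.ofReal (gaussDensity d θ x) *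
        ENNReal.ofReal (‖f x - θ‖ ^ 2) ∂π ∂volume :=
        lintegral_lintegral_swap hm.aemeasurable
    _ = _ := by
        refine lintegral_congr fun x => ?_
        rw [posterior, lintegral_withDensity_eq_lintegral_mul _
          (measurable_gaussDensity_left d x).ennreal_ofReal
          (Measurable.ennreal_ofReal (by fun_prop))]
        rfl

/-- The average minimizes the mean squared distance. -/
lemma lintegral_sq_dist_average_le {F : Type*} [NormedAddCommGroup F] [InnerProductSpace ℝ F]
    [CompleteSpace F] [SecondCountableTopology F] [MeasurableSpace F] [BorelSpace F]
    (ρ : Measure F) [IsFiniteMeasure ρ] {B : ℝ} (hB : ∀ᵐ θ ∂ρ, ‖θ‖ ≤ B) (a : F) :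
    ∫⁻ θ, ENNReal.ofReal (‖(⨍ y, y ∂ρ) - θ‖ ^ 2) ∂ρ ≤
      ∫⁻ θ, ENNReal.ofReal (‖a - θ‖ ^ 2) ∂ρ := by
  set m := ⨍ y, y ∂ρ with hm
  have hid : Integrable (fun θ : F => θ) ρ :=
    Integrable.of_bound aestronglyMeasurable_id B hB
  have hint (c : F) : Integrable (fun θ => ‖c - θ‖ ^ 2) ρ := by
    refine Integrable.of_bound (by fun_prop) ((‖c‖ + B) ^ 2) ?_
    filter_upwards [hB] with θ hθ
    rw [norm_pow, norm_norm]
    gcongr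
    exact (norm_sub_le _ _).trans (by gcongr)
  rw [← ofReal_integral_eq_lintegral_ofReal (hint m) (.of_forall fun _ => by positivity),
    ← ofReal_integral_eq_lintegral_ofReal (hint a) (.of_forall fun _ => by positivity)]
  refine ENNReal.ofReal_le_ofReal ?_
  have hexp (θ : F) : ‖a - θ‖ ^ 2 = ‖m - θ‖ ^ 2 + (‖a - m‖ ^ 2 + 2 * inner ℝ (a - m) (m - θ)) := by
    rw [show a - θ = (a - m) + (m - θ) by abel, norm_add_sq_real]
    ring
  have h0 : ∫ θ, (m - θ) ∂ρ = 0 := by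
    rw [integral_sub (integrable_const _) hid, integral_const, hm, measure_smul_average, sub_self]
  have hsub : Integrable (fun θ => m - θ) ρ := (integrable_const m).sub hid
  have hinn : Integrable (fun θ => 2 * inner ℝ (a - m) (m - θ)) ρ :=
    (hsub.const_inner (a - m)).const_mul 2
  rw [funext hexp]
  have hadd : Integrable (fun θ => ‖a - m‖ ^ 2 + 2 * inner ℝ (a - m) (m - θ)) ρ :=
    (integrable_const _).add hinn
  rw [integral_add (hint m) hadd, integral_add (integrable_const _) hinn,
    integral_const_mul, integral_inner hsub, h0, inner_zero_right]
  simp only [integral_const, smul_eq_mul, mul_zero, add_zero]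
  have : 0 ≤ ρ.real Set.univ * ‖a - m‖ ^ 2 := by positivity
  linarith

/-- By Tonelli the integrated risk is an integral over x of posterior mean squared distances, so the
minimization can be done for each x separately. -/
lemma integratedRisk_posteriorMean_le {d : ℕ} {f : E d → E d} (hf : Measurable f)
    (π : Measure (E d)) [IsFiniteMeasure π] {B : ℝ} (hπ : ∀ᵐ θ ∂π, ‖θ‖ ≤ B) :
    integratedRisk (posteriorMean π) π ≤ integratedRisk f π := by
  rw [integratedRisk_eq_lintegral_posterior hf,
    integratedRisk_eq_lintegral_posterior (measurable_posteriorMean π)]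
  refine lintegral_mono fun x => ?_
  exact lintegral_sq_dist_average_le (posterior π x) ((withDensity_absolutelyContinuous _ _).ae_le hπ) (f x)

lemma risk_congr_ae {d : ℕ} {f g : E d → E d} (h : f =ᵐ[volume] g) (θ : E d) :
    risk f θ = risk g θ := by
  refine lintegral_congr_ae ?_
  rw [normalLaw_eq_withDensity]
  filter_upwards [(withDensity_absolutelyContinuous volume _).ae_le h] with x hx
  rw [hx]

lemma integratedRisk_minOracle_le {d N : ℕ} [NeZero d] [NeZero N] {b : Fin N → ℝ} {B : ℝ}
    (hb : ∀ i, 0 < b i) (hB : ∀ i, b i ≤ B) {f : E d → E d} (hf : Measurable f) :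
    integratedRisk (minOracle b) (radialExtension d (empirical b)) ≤
      integratedRisk f (radialExtension d (empirical b)) := by
  refine le_trans (le_of_eq ?_) (integratedRisk_posteriorMean_le hf _
    (radialExtension_ae_norm_le (d := d) (b := b) (B := B)
      fun i => by rw [abs_of_pos (hb i)]; exact hB i))
  refine lintegral_congr fun θ => risk_congr_ae ?_ θ
  have : ∀ᵐ x : E d, x ≠ 0 := by
    rw [ae_iff]
    simp
  filter_upwards [this] with x hx using minOracle_eq_posteriorMean hb hx

/-! ### Risks of estimators -/

lemma measurable_risk_uncurry {d : ℕ} {Ω : Type*} [MeasurableSpace Ω] {f : Ω → E d → E d}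
    (hf : Measurable (Function.uncurry f)) :
    Measurable fun p : Ω × E d => risk (f p.1) p.2 := by
  -- Writing X = θ + z removes θ from the measure, so that measurability of parametric integrals
  -- applies.
  have h (ω : Ω) (θ : E d) : risk (f ω) θ =
      ∫⁻ z, ENNReal.ofReal (‖f ω (θ + z) - θ‖ ^ 2) ∂(stdGaussian (E d)) := by
    have hfω : Measurable (f ω) := hf.of_uncurry_left
    rw [risk, normalLaw_eq_map, lintegral_map (Measurable.ennreal_ofReal (by fun_prop))
      (by fun_prop)]
  simp_rw [h]
  refine Measurable.lintegral_prod_right' (ν := stdGaussian (E d))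
    (f := fun q : (Ω × E d) × E d =>
      ENNReal.ofReal (‖f q.1.1 (q.1.2 + q.2) - q.1.2‖ ^ 2)) ?_
  have : Measurable fun q : (Ω × E d) × E d => f q.1.1 (q.1.2 + q.2) :=
    hf.comp (by fun_prop : Measurable fun q : (Ω × E d) × E d => (q.1.1, q.1.2 + q.2))
  exact Measurable.ennreal_ofReal (by fun_prop)

lemma measurable_risk {d : ℕ} {f : E d → E d} (hf : Measurable f) : Measurable (risk f) :=
  (measurable_risk_uncurry (Ω := Unit) (f := fun _ => f) (hf.comp measurable_snd)).comp
    (by fun_prop : Measurable fun θ : E d => ((), θ))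

/-- Weak duality: the supremum over θ dominates the average over the prior, and after exchanging the
two averages each realization of the randomized estimator has at least the Bayes risk. -/
lemma bayesRisk_le_minimaxRisk {d : ℕ} {B : ℝ} (π : Measure (E d)) [IsProbabilityMeasure π]
    (hπ : ∀ᵐ θ ∂π, θ ∈ paramSpace d B) : bayesRisk d B π ≤ minimaxRisk d B := by
  refine le_iInf fun r => ?_
  let _ := r.mΩ
  have := r.isProb
  have hm : Measurable fun p : E d × r.Ω => risk (r.est p.2) p.1 :=
    (measurable_risk_uncurry r.measurable_est).comp measurable_swap
  calc bayesRisk d B π = ∫⁻ _, bayesRisk d B π ∂r.law := by simp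
    _ ≤ ∫⁻ ω, ∫⁻ θ, risk (r.est ω) θ ∂π ∂r.law := by
        refine lintegral_mono fun ω => ?_
        exact iInf₂_le (r.est ω) ⟨r.measurable_est.of_uncurry_left, r.est_mem ω⟩
    _ = ∫⁻ θ, r.risk θ ∂π := (lintegral_lintegral_swap hm.aemeasurable).symm
    _ ≤ ∫⁻ _, (⨆ θ ∈ paramSpace d B, r.risk θ) ∂π := by
        refine lintegral_mono_ae ?_
        filter_upwards [hπ] with θ hθ
        exact le_iSup₂ (f := fun θ (_ : θ ∈ paramSpace d B) => r.risk θ) θ hθ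
    _ = _ := by simp

lemma minimaxRisk_le_worstCaseRisk {d : ℕ} {B : ℝ} {f : E d → E d} (hf : f ∈ detEstimators d B) :
    minimaxRisk d B ≤ worstCaseRisk B f := by
  let r : RandomizedEstimator d B :=
    { Ω := Unit
      mΩ := inferInstance
      law := Measure.dirac ()
      isProb := inferInstance
      est := fun _ => f
      measurable_est := hf.1.comp measurable_snd
      est_mem := fun _ => hf.2 }
  refine (iInf_le _ r).trans (le_of_eq ?_)
  simp [r, RandomizedEstimator.risk, worstCaseRisk]

/-- The risk as a real number. -/
def realRisk {d : ℕ} (f : E d → E d) (θ : E d) : ℝ := ∫ x, ‖f x - θ‖ ^ 2 ∂(normalLaw θ)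

lemma sq_dist_le {d : ℕ} {B : ℝ} {f : E d → E d} (hf : f ∈ detEstimators d B) {θ : E d}
    (hθ : ‖θ‖ ≤ B) (x : E d) : ‖f x - θ‖ ^ 2 ≤ 4 * B ^ 2 := by
  have h1 : ‖f x‖ ≤ B := by simpa [paramSpace] using hf.2 x
  have h2 : ‖f x - θ‖ ≤ 2 * B := (norm_sub_le _ _).trans (by linarith)
  calc ‖f x - θ‖ ^ 2 ≤ (2 * B) ^ 2 := by gcongr
    _ = _ := by ring

lemma measurable_sq_dist {d : ℕ} {B : ℝ} {f : E d → E d} (hf : f ∈ detEstimators d B) (θ : E d) :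
    Measurable fun x => ‖f x - θ‖ ^ 2 := by
  have := hf.1
  fun_prop

lemma integrable_sq_dist {d : ℕ} {B : ℝ} {f : E d → E d} (hf : f ∈ detEstimators d B) {θ : E d}
    (hθ : ‖θ‖ ≤ B) (θ' : E d) : Integrable (fun x => ‖f x - θ‖ ^ 2) (normalLaw θ') := by
  refine Integrable.of_bound (measurable_sq_dist hf θ).aestronglyMeasurable (4 * B ^ 2)
    (.of_forall fun x => ?_)
  rw [Real.norm_of_nonneg (by positivity)]
  exact sq_dist_le hf hθ x

lemma realRisk_nonneg {d : ℕ} (f : E d → E d) (θ : E d) : 0 ≤ realRisk f θ :=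
  integral_nonneg fun _ => by positivity

lemma realRisk_le {d : ℕ} {B : ℝ} {f : E d → E d} (hf : f ∈ detEstimators d B) {θ : E d}
    (hθ : ‖θ‖ ≤ B) : realRisk f θ ≤ 4 * B ^ 2 := by
  calc realRisk f θ ≤ ∫ _, 4 * B ^ 2 ∂(normalLaw θ) :=
        integral_mono (integrable_sq_dist hf hθ θ) (integrable_const _) (sq_dist_le hf hθ)
    _ = _ := by simp

lemma risk_eq_ofReal {d : ℕ} {B : ℝ} {f : E d → E d} (hf : f ∈ detEstimators d B) {θ : E d}
    (hθ : ‖θ‖ ≤ B) : risk f θ = ENNReal.ofReal (realRisk f θ) := by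
  rw [risk, realRisk, ofReal_integral_eq_lintegral_ofReal (integrable_sq_dist hf hθ θ)
    (.of_forall fun _ => by positivity)]

/-- The risk of a bounded estimator is a Lipschitz function of the parameter. -/
lemma realRisk_sub_le {d : ℕ} {B : ℝ} {f : E d → E d} (hf : f ∈ detEstimators d B)
    {θ θ' : E d} (hθ : ‖θ‖ ≤ B) (hθ' : ‖θ'‖ ≤ B) :
    realRisk f θ - realRisk f θ' ≤ 8 * B * (B + 1) * ‖θ - θ'‖ := by
  have hB : 0 ≤ B := (norm_nonneg _).trans hθ
  have hi := integrable_sq_dist hf hθ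
  -- First move the target with the law fixed: a difference of squares of numbers in [0, 2B].
  have h1 : ∫ x, ‖f x - θ‖ ^ 2 ∂(normalLaw θ') - realRisk f θ' ≤ 4 * B * ‖θ - θ'‖ := by
    rw [realRisk, ← integral_sub (hi θ') (integrable_sq_dist hf hθ' θ')]
    calc _ ≤ ∫ _, 4 * B * ‖θ - θ'‖ ∂(normalLaw θ') := by
          refine integral_mono ((hi θ').sub (integrable_sq_dist hf hθ' θ')) (integrable_const _)
            fun x => ?_
          have hx : ‖f x‖ ≤ B := by simpa [paramSpace] using hf.2 x
          have ha : ‖f x - θ‖ ≤ 2 * B := (norm_sub_le _ _).trans (by linarith)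
          have hb : ‖f x - θ'‖ ≤ 2 * B := (norm_sub_le _ _).trans (by linarith)
          have hc : ‖f x - θ‖ ≤ ‖f x - θ'‖ + ‖θ - θ'‖ := by
            have := norm_sub_le (f x - θ') (θ - θ')
            rwa [sub_sub_sub_cancel_right] at this
          have h0 := norm_nonneg (θ - θ')
          have h0a := norm_nonneg (f x - θ)
          have h0b := norm_nonneg (f x - θ')
          simp only
          nlinarith
      _ = _ := by simp
  -- Then move the law: the loss is at most 4B², times the L¹ distance of the densities. The total
  -- 4B + 8B² is at most 8B(B + 1).
  have h2 : realRisk f θ - ∫ x, ‖f x - θ‖ ^ 2 ∂(normalLaw θ') ≤ 4 * B ^ 2 * (2 * ‖θ - θ'‖) := by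
    have i1 := (integrable_normalLaw_iff θ _).1 (hi θ)
    have i2 := (integrable_normalLaw_iff θ' _).1 (hi θ')
    have i3 := ((integrable_gaussDensity θ).sub (integrable_gaussDensity θ')).abs
    rw [realRisk, integral_normalLaw, integral_normalLaw, ← integral_sub i1 i2]
    calc _ ≤ ∫ x, 4 * B ^ 2 * |gaussDensity d θ x - gaussDensity d θ' x| := by
          refine integral_mono (i1.sub i2) (i3.const_mul _) fun x => ?_
          have := sq_dist_le hf hθ x
          have h0 : 0 ≤ ‖f x - θ‖ ^ 2 := by positivity
          simp only
          rw [← sub_mul, mul_comm (4 * B ^ 2)]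
          calc _ ≤ |gaussDensity d θ x - gaussDensity d θ' x| * ‖f x - θ‖ ^ 2 := by
                gcongr; exact le_abs_self _
            _ ≤ _ := by gcongr
      _ ≤ _ := by
          rw [integral_const_mul]
          gcongr
          exact integral_abs_gaussDensity_sub_le' d θ θ'
  have h0 := norm_nonneg (θ - θ')
  nlinarith [mul_nonneg hB h0]

/-- The risk of an equivariant estimator is invariant under linear isometries. -/
lemma risk_map_isometry {d : ℕ} {f : E d → E d} (hf : Measurable f) (Q : E d ≃ₗᵢ[ℝ] E d)
    (hfQ : ∀ x, f (Q x) = Q (f x)) (θ : E d) : risk f (Q θ) = risk f θ := by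
  rw [risk, ← normalLaw_map_isometry, lintegral_map (Measurable.ennreal_ofReal (by fun_prop))
    Q.continuous.measurable]
  simp_rw [hfQ, ← map_sub, LinearIsometryEquiv.norm_map]
  rfl

/-- A reflection exchanges two vectors of equal norm, and the oracle is equivariant. This reduces
nature's choice to a radius. -/
lemma risk_minOracle_eq {d N : ℕ} [NeZero d] {b : Fin N → ℝ}
    (hm : Measurable (minOracle b : E d → E d)) {θ θ' : E d} (h : ‖θ‖ = ‖θ'‖) :
    risk (minOracle b) θ = risk (minOracle b) θ' := by
  rw [← Submodule.reflection_sub h]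
  exact (risk_map_isometry hm _ (minOracle_map_isometry b _) θ).symm

/-! ### Sub-Gaussian sums on product spaces -/

lemma hasSubgaussianMGF_pi_sum {ι : Type*} [Fintype ι] {X : ι → Type*}
    [∀ i, MeasurableSpace (X i)] (μ : ∀ i, Measure (X i)) [∀ i, IsProbabilityMeasure (μ i)]
    {u : ∀ i, X i → ℝ} {c : NNReal} (hu : ∀ i, Measurable (u i))
    (h : ∀ i, HasSubgaussianMGF (u i) c (μ i)) :
    HasSubgaussianMGF (fun x => ∑ i, u i (x i)) (Fintype.card ι * c) (Measure.pi μ) := by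
  have h1 : ∀ i ∈ Finset.univ, HasSubgaussianMGF (fun x : ∀ i, X i => u i (x i)) c
      (Measure.pi μ) := fun i _ => by
    refine HasSubgaussianMGF.of_map (Y := fun x : ∀ i, X i => x i)
      (measurable_pi_apply i).aemeasurable (X := u i) ?_
    rw [(measurePreserving_eval μ i).map_eq]
    exact h i
  have := HasSubgaussianMGF.sum_of_iIndepFun
    (iIndepFun_pi (μ := μ) (X := u) fun i => (hu i).aemeasurable) h1
  simpa using this

/-- An integrable upper bound for finitely many sub-Gaussian random variables. -/
lemma exists_integrable_bound_of_subgaussian {Ω : Type*} [MeasurableSpace Ω] {ν : Measure Ω}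
    [IsProbabilityMeasure ν] {n : ℕ} (hn : 0 < n) {Y : Fin n → Ω → ℝ} {c : NNReal}
    (hY : ∀ j, HasSubgaussianMGF (Y j) c ν) {l : ℝ} (hl : 0 < l) :
    ∃ Γ : Ω → ℝ, Integrable Γ ν ∧ (∀ ω j, |Y j ω| ≤ Γ ω) ∧
      ∫ ω, Γ ω ∂ν ≤ (Real.log (2 * n) + c * l ^ 2 / 2) / l := by
  have hn' : (0 : ℝ) < n := by exact_mod_cast hn
  set K : ℝ := 2 * n * Real.exp (c * l ^ 2 / 2)
  have hK : 0 < K := by positivity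
  set S : Ω → ℝ := fun ω => ∑ j, (Real.exp (l * Y j ω) + Real.exp (-l * Y j ω)) with hS
  have hi j : Integrable (fun ω => Real.exp (l * Y j ω) + Real.exp (-l * Y j ω)) ν :=
    ((hY j).integrable_exp_mul l).add ((hY j).integrable_exp_mul (-l))
  have hSi : Integrable S ν := integrable_finsetSum _ fun j _ => hi j
  -- The pointwise bound would be log S / l; its tangent at S = K is used instead. It is affine in
  -- S, so E S ≤ K gives an expectation of at most log K / l.
  refine ⟨fun ω => (Real.log K - 1 + S ω / K) / l, ?_, fun ω j => ?_, ?_⟩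
  · exact ((integrable_const _).add (hSi.div_const K)).div_const l
  · rw [le_div_iff₀ hl]
    have h1 : Real.exp (l * |Y j ω|) ≤ S ω := by
      have h2 : Real.exp (l * |Y j ω|) ≤ Real.exp (l * Y j ω) + Real.exp (-l * Y j ω) := by
        rcases abs_cases (Y j ω) with ⟨h, _⟩ | ⟨h, _⟩
        · rw [h]; linarith [Real.exp_pos (-l * Y j ω)]
        · rw [h, mul_neg, ← neg_mul]; linarith [Real.exp_pos (l * Y j ω)]
      exact h2.trans (Finset.single_le_sum
        (f := fun j => Real.exp (l * Y j ω) + Real.exp (-l * Y j ω))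
        (fun j _ => by positivity) (Finset.mem_univ j))
    have h3 := Real.add_one_le_exp (l * |Y j ω| - Real.log K)
    rw [Real.exp_sub, Real.exp_log hK] at h3
    have h4 : Real.exp (l * |Y j ω|) / K ≤ S ω / K := by gcongr
    linarith
  · rw [integral_div, integral_add (integrable_const _) (hSi.div_const K), integral_div]
    have h1 : ∫ ω, S ω ∂ν ≤ K := by
      simp only [hS]
      rw [integral_finsetSum _ fun j _ => hi j]
      calc _ ≤ ∑ _j : Fin n, 2 * Real.exp (c * l ^ 2 / 2) := by
            refine Finset.sum_le_sum fun j _ => ?_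
            rw [integral_add ((hY j).integrable_exp_mul l) ((hY j).integrable_exp_mul (-l))]
            have h1 := (hY j).mgf_le l
            have h2 := (hY j).mgf_le (-l)
            rw [neg_sq] at h2
            simp only [mgf] at h1 h2
            linarith
        _ = K := by simp [K]; ring
    have h2 : (∫ ω, S ω ∂ν) / K ≤ 1 := (div_le_one hK).2 h1
    have h3 : Real.log K = Real.log (2 * n) + c * l ^ 2 / 2 := by
      rw [Real.log_mul (by positivity) (Real.exp_ne_zero _), Real.log_exp]
    refine div_le_div_of_nonneg_right ?_ hl.le
    simp only [integral_const, probReal_univ, smul_eq_mul, one_mul]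
    linarith

/-! ### The exponential distribution -/

lemma exponentialPDFReal_eq (η x : ℝ) :
    exponentialPDFReal η x = if 0 ≤ x then η * Real.exp (-(η * x)) else 0 := by
  simp [exponentialPDFReal, gammaPDFReal]

lemma integral_expMeasure {η : ℝ} (hη : 0 < η) (h : ℝ → ℝ) :
    ∫ s, h s ∂(expMeasure η) = ∫ s, exponentialPDFReal η s * h s := by
  have : expMeasure η = volume.withDensity (fun s => ENNReal.ofReal (exponentialPDFReal η s)) := rfl
  rw [this, integral_withDensity_eq_integral_toReal_smul
    (measurable_exponentialPDFReal η).ennreal_ofReal (by simp)]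
  congr 1
  ext s
  rw [ENNReal.toReal_ofReal (exponentialPDFReal_nonneg hη s), smul_eq_mul]

lemma integrable_expMeasure_iff {η : ℝ} (hη : 0 < η) (h : ℝ → ℝ) :
    Integrable h (expMeasure η) ↔ Integrable fun s => exponentialPDFReal η s * h s := by
  have : expMeasure η = volume.withDensity (fun s => ENNReal.ofReal (exponentialPDFReal η s)) := rfl
  rw [this, integrable_withDensity_iff_integrable_smul'
    (measurable_exponentialPDFReal η).ennreal_ofReal (by simp)]
  refine integrable_congr (.of_forall fun s => ?_)
  simp only
  rw [ENNReal.toReal_ofReal (exponentialPDFReal_nonneg hη s), smul_eq_mul]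

lemma integral_id_expMeasure {η : ℝ} (hη : 0 < η) : ∫ s, s ∂(expMeasure η) = 1 / η := by
  rw [integral_expMeasure hη]
  have h1 : (fun s => exponentialPDFReal η s * s) =
      Set.indicator (Set.Ioi 0) fun s => η * (s ^ ((2 : ℝ) - 1) * Real.exp (-(η * s))) := by
    ext s
    rw [exponentialPDFReal_eq, Set.indicator]
    rcases lt_trichotomy s 0 with h | h | h
    · simp [h.not_ge, h.le]
    · simp [h]
    · simp only [h.le, h, Set.mem_Ioi, if_true]
      norm_num
      ring
  rw [h1, integral_indicator measurableSet_Ioi, integral_const_mul,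
    Real.integral_rpow_mul_exp_neg_mul_Ioi (by norm_num) hη, Real.Gamma_two]
  have : (1 / η) ^ (2 : ℝ) = (1 / η) ^ 2 := by norm_num
  rw [this]
  field_simp

lemma integrable_id_expMeasure {η : ℝ} (hη : 0 < η) :
    Integrable (fun s : ℝ => s) (expMeasure η) := by
  -- As above, a non-integrable function would have integral 0 instead of 1/η.
  by_contra hc
  have := integral_id_expMeasure hη
  rw [integral_undef hc] at this
  exact (one_div_pos.2 hη).ne this

lemma ae_nonneg_expMeasure (η : ℝ) : ∀ᵐ s ∂(expMeasure η), 0 ≤ s := by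
  have : expMeasure η = volume.withDensity (fun s => ENNReal.ofReal (exponentialPDFReal η s)) := rfl
  rw [this, ae_withDensity_iff (measurable_exponentialPDFReal η).ennreal_ofReal]
  refine .of_forall fun s hs => ?_
  by_contra h
  simp [exponentialPDFReal_eq, h] at hs

/-- The effect of a shift on the expectation of a bounded function. -/
lemma integral_expMeasure_shift_le {η a B : ℝ} (hη : 0 < η) (ha : 0 ≤ a) {h : ℝ → ℝ}
    (hm : Measurable h) (h0 : ∀ s, 0 ≤ h s) (hB : ∀ s, h s ≤ B) :
    ∫ s, (h (s + a) - h (s - a)) ∂(expMeasure η) ≤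
      B * (Real.exp (η * a) - Real.exp (-(η * a))) := by
  have := isProbabilityMeasure_expMeasure hη
  have hi (g : ℝ → ℝ) (hg : Measurable g) (h1 : ∀ s, 0 ≤ g s) (h2 : ∀ s, g s ≤ B) :
      Integrable g (expMeasure η) := by
    refine Integrable.of_bound hg.aestronglyMeasurable B (.of_forall fun s => ?_)
    rw [Real.norm_of_nonneg (h1 s)]
    exact h2 s
  have i0 := hi h hm h0 hB
  have i1 := hi (fun s => h (s + a)) (by fun_prop) (fun s => h0 _) (fun s => hB _)
  have i2 := hi (fun s => h (s - a)) (by fun_prop) (fun s => h0 _) (fun s => hB _)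
  have i0' := (integrable_expMeasure_iff hη _).1 i0
  have i1' := (integrable_expMeasure_iff hη _).1 i1
  have i2' := (integrable_expMeasure_iff hη _).1 i2
  rw [integral_sub i1 i2]
  have hI0 : ∫ s, h s ∂(expMeasure η) ≤ B := by
    calc _ ≤ ∫ _, B ∂(expMeasure η) := integral_mono i0 (integrable_const _) hB
      _ = B := by simp
  -- For the exponential density p and a ≥ 0, p(s - a) ≤ exp(ηa) p(s), and below exp(-ηa) p(s) ≤ p(s
  -- + a), for all real s.
  have e1 : ∫ s, h (s + a) ∂(expMeasure η) ≤ Real.exp (η * a) * ∫ s, h s ∂(expMeasure η) := by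
    rw [integral_expMeasure hη, integral_expMeasure hη, ← integral_const_mul]
    have h1 := integral_sub_right_eq_self (μ := volume) (fun s => exponentialPDFReal η s * h (s + a)) a
    rw [← h1]
    refine integral_mono (i1'.comp_sub_right a) (i0'.const_mul _) fun s => ?_
    simp only [sub_add_cancel, exponentialPDFReal_eq]
    rw [← mul_assoc]
    gcongr
    · exact h0 s
    · split_ifs with h2 h3
      · rw [mul_left_comm, ← Real.exp_add]
        apply le_of_eq
        ring_nf
      · linarith
      · positivity
      · simp
  have e2 : Real.exp (-(η * a)) * ∫ s, h s ∂(expMeasure η) ≤ ∫ s, h (s - a) ∂(expMeasure η) := by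
    rw [integral_expMeasure hη, integral_expMeasure hη, ← integral_const_mul]
    have h1 := integral_add_right_eq_self (μ := volume) (fun s => exponentialPDFReal η s * h (s - a)) a
    rw [← h1]
    refine integral_mono (i0'.const_mul _) (i2'.comp_add_right a) fun s => ?_
    simp only [add_sub_cancel_right, exponentialPDFReal_eq]
    rw [← mul_assoc]
    gcongr
    · exact h0 s
    · split_ifs with h2 h3
      · rw [mul_left_comm, ← Real.exp_add]
        apply le_of_eq
        ring_nf
      · linarith
      · simp; positivity
      · simp
  have h3 : Real.exp (-(η * a)) ≤ Real.exp (η * a) :=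
    Real.exp_le_exp.2 (by nlinarith [mul_nonneg hη.le ha])
  nlinarith

/-! ### Follow the perturbed leader on a finite set of reals -/

section Leader

variable {n : ℕ} {pick : (Fin n → ℝ) → Fin n} {b : Fin n → ℝ} {g : ℕ → Fin n → ℝ}

/-- The cumulative reward of the first `t` rounds. -/
def cumReward (g : ℕ → Fin n → ℝ) (t : ℕ) (j : Fin n) : ℝ := ∑ i ∈ Finset.range t, g i j

/-- The perturbed leader after `t` rounds. -/
def leader (pick : (Fin n → ℝ) → Fin n) (b : Fin n → ℝ) (g : ℕ → Fin n → ℝ) (t : ℕ) (σ : ℝ) :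
    Fin n := pick fun j => cumReward g t j + σ * b j

lemma le_leader (hp : ArgmaxRule n pick) (t : ℕ) (σ : ℝ) (j : Fin n) :
    cumReward g t j + σ * b j ≤
      cumReward g t (leader pick b g t σ) + σ * b (leader pick b g t σ) :=
  hp.le_pick (fun j => cumReward g t j + σ * b j) j

lemma measurable_leader (hp : ArgmaxRule n pick) (t : ℕ) : Measurable (leader pick b g t) :=
  hp.measurable.comp (measurable_pi_lambda _ fun j => by fun_prop)

/-- Adding the two optimality conditions gives (τ - σ)(b_τ - b_σ) ≥ 0, whatever the tie-breaking. -/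
lemma leader_mono (hp : ArgmaxRule n pick) (t : ℕ) {σ τ : ℝ} (h : σ ≤ τ) :
    b (leader pick b g t σ) ≤ b (leader pick b g t τ) := by
  rcases h.eq_or_lt with rfl | h
  · rfl
  have h1 := le_leader (g := g) (b := b) hp t σ (leader pick b g t τ)
  have h2 := le_leader (g := g) (b := b) hp t τ (leader pick b g t σ)
  by_contra! hc
  nlinarith

/-- Near-optimal choices for the rewards of `t` rounds are close to the leader after `t + 1`
rounds. -/
lemma abs_sub_leader_le (hp : ArgmaxRule n pick) {t : ℕ} {L γ σ : ℝ} (hL : 0 < L) (hγ : 0 ≤ γ)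
    (hg : ∀ j k, g t j - g t k ≤ L * |b j - b k|) {k : Fin n}
    (hk : ∀ m, cumReward g t m + σ * b m ≤ cumReward g t k + σ * b k + γ) :
    L * |b k - b (leader pick b g (t + 1) σ)| ≤
      L * (b (leader pick b g (t + 1) (σ + 2 * L)) - b (leader pick b g (t + 1) (σ - 2 * L))) +
        γ := by
  have hs (j : Fin n) : cumReward g (t + 1) j = cumReward g t j + g t j := by
    simp [cumReward, Finset.sum_range_succ]
  -- Add the two optimality conditions: the extra slope 2L against the Lipschitz constant L of the
  -- new reward leaves a net slope L.
  have hup : L * (b k - b (leader pick b g (t + 1) (σ + 2 * L))) ≤ γ := by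
    set m := leader pick b g (t + 1) (σ + 2 * L) with hm
    have h1 := le_leader (g := g) (b := b) hp (t + 1) (σ + 2 * L) k
    rw [← hm, hs, hs] at h1
    have h2 := hk m
    have h3 := hg m k
    rcases le_total (b k) (b m) with h | h
    · nlinarith
    · rw [abs_of_nonpos (by linarith)] at h3
      nlinarith
  have hlo : L * (b (leader pick b g (t + 1) (σ - 2 * L)) - b k) ≤ γ := by
    set m := leader pick b g (t + 1) (σ - 2 * L) with hm
    have h1 := le_leader (g := g) (b := b) hp (t + 1) (σ - 2 * L) k
    rw [← hm, hs, hs] at h1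
    have h2 := hk m
    have h3 := hg m k
    rcases le_total (b m) (b k) with h | h
    · nlinarith
    · rw [abs_of_nonneg (by linarith)] at h3
      nlinarith
  -- The leader at σ lies between the leaders at σ - 2L and σ + 2L, and so does `b k` up to γ / L.
  have m1 := leader_mono (g := g) (b := b) hp (t + 1) (show σ ≤ σ + 2 * L by linarith)
  have m2 := leader_mono (g := g) (b := b) hp (t + 1) (show σ - 2 * L ≤ σ by linarith)
  rcases abs_cases (b k - b (leader pick b g (t + 1) σ)) with ⟨h, _⟩ | ⟨h, _⟩ <;> rw [h] <;> nlinarith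

/-- Be the leader. -/
lemma cumReward_le_sum_leader (hp : ArgmaxRule n pick) (hb0 : ∀ j, 0 ≤ b j) {B : ℝ}
    (hB : ∀ j, b j ≤ B) {σ : ℝ} (hσ : 0 ≤ σ) (T : ℕ) (k : Fin n) :
    cumReward g T k ≤ ∑ t ∈ Finset.range T, g t (leader pick b g (t + 1) σ) + σ * B := by
  -- The perturbation acts as the reward of a round zero, worth at most σB.
  have key : ∀ T, cumReward g T (leader pick b g T σ) + σ * b (leader pick b g T σ) ≤
      ∑ t ∈ Finset.range T, g t (leader pick b g (t + 1) σ) + σ * B := by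
    intro T
    induction T with
    | zero =>
      simp only [cumReward, Finset.range_zero, Finset.sum_empty, zero_add]
      exact mul_le_mul_of_nonneg_left (hB _) hσ
    | succ T ih =>
      have h := le_leader (g := g) (b := b) hp T σ (leader pick b g (T + 1) σ)
      rw [Finset.sum_range_succ]
      have : cumReward g (T + 1) (leader pick b g (T + 1) σ) =
          cumReward g T (leader pick b g (T + 1) σ) + g T (leader pick b g (T + 1) σ) := by
        simp [cumReward, Finset.sum_range_succ]
      rw [this]
      linarith
  have h1 := le_leader (g := g) (b := b) hp T σ k
  have h2 := mul_nonneg hσ (hb0 k)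
  linarith [key T]

lemma integrable_comp_fin {Ω : Type*} [MeasurableSpace Ω] {ν : Measure Ω} [IsFiniteMeasure ν]
    {K : Ω → Fin n} (hK : Measurable K) (v : Fin n → ℝ) : Integrable (fun ω => v (K ω)) ν := by
  refine Integrable.of_bound ((measurable_of_finite v).comp hK).aestronglyMeasurable
    (∑ j, |v j|) (.of_forall fun ω => ?_)
  exact Finset.single_le_sum (f := fun j => |v j|) (fun j _ => abs_nonneg _)
    (Finset.mem_univ (K ω))

/-- One round of follow the perturbed leader with an approximate oracle. -/
lemma integral_leader_le (hp : ArgmaxRule n pick) (hb0 : ∀ j, 0 ≤ b j) {B : ℝ}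
    (hB : ∀ j, b j ≤ B) {t : ℕ} {L η : ℝ} (hL : 0 < L) (hη : 0 < η)
    (hg : ∀ j k, g t j - g t k ≤ L * |b j - b k|)
    {Ω : Type*} [MeasurableSpace Ω] {ν : Measure Ω} [IsProbabilityMeasure ν]
    {O : Ω → Fin n → ℝ} (hO : Measurable O) {Γ : Ω → ℝ} (hΓ : Integrable Γ ν)
    (hOΓ : ∀ ω j, |O ω j - cumReward g t j| ≤ Γ ω) :
    ∫ σ, g t (leader pick b g (t + 1) σ) ∂(expMeasure η) ≤
      ∫ y, g t (pick fun j => O y.2 j + y.1 * b j) ∂((expMeasure η).prod ν) +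
        L * (B * (Real.exp (η * (2 * L)) - Real.exp (-(η * (2 * L))))) + 2 * ∫ ω, Γ ω ∂ν := by
  have := isProbabilityMeasure_expMeasure hη
  have hml := measurable_leader (b := b) (g := g) hp (t + 1)
  have hmb : Measurable fun σ => b (leader pick b g (t + 1) σ) := (measurable_of_finite b).comp hml
  set K : ℝ × Ω → Fin n := fun y => pick fun j => O y.2 j + y.1 * b j
  have hK : Measurable K := hp.measurable.comp (measurable_pi_lambda _ fun j => by fun_prop)
  set D : ℝ → ℝ := fun σ => b (leader pick b g (t + 1) (σ + 2 * L)) -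
    b (leader pick b g (t + 1) (σ - 2 * L))
  have hpt (y : ℝ × Ω) : g t (leader pick b g (t + 1) y.1) ≤
      g t (K y) + (L * D y.1 + 2 * Γ y.2) := by
    have h1 := hg (leader pick b g (t + 1) y.1) (K y)
    rw [abs_sub_comm] at h1
    have hΓ0 : 0 ≤ Γ y.2 := (abs_nonneg _).trans (hOΓ y.2 (K y))
    -- The oracle and the leader are coupled through the same σ. The estimation error enters at both
    -- points compared, hence 2Γ.
    have h2 := abs_sub_leader_le (g := g) (b := b) (σ := y.1) (γ := 2 * Γ y.2) hp hL
      (by positivity) hg (k := K y) fun m => by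
        have h3 := hp.le_pick (fun j => O y.2 j + y.1 * b j) m
        have h4 := abs_le.1 (hOΓ y.2 m)
        have h5 := abs_le.1 (hOΓ y.2 (K y))
        change O y.2 m + y.1 * b m ≤ O y.2 (K y) + y.1 * b (K y) at h3
        linarith
    linarith
  have iD : Integrable D (expMeasure η) :=
    (integrable_comp_fin (hml.comp (by fun_prop)) b).sub
      (integrable_comp_fin (hml.comp (by fun_prop)) b)
  have i1 : Integrable (fun y : ℝ × Ω => L * D y.1) ((expMeasure η).prod ν) :=
    (iD.const_mul L).comp_fst ν
  have i2 : Integrable (fun y : ℝ × Ω => 2 * Γ y.2) ((expMeasure η).prod ν) :=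
    (hΓ.const_mul 2).comp_snd _
  have i3 : Integrable (fun y => g t (K y)) ((expMeasure η).prod ν) := integrable_comp_fin hK _
  have i4 : Integrable (fun y : ℝ × Ω => g t (leader pick b g (t + 1) y.1))
      ((expMeasure η).prod ν) := integrable_comp_fin (hml.comp measurable_fst) _
  have i5 : Integrable (fun y : ℝ × Ω => L * D y.1 + 2 * Γ y.2) ((expMeasure η).prod ν) := i1.add i2
  have e1 : ∫ y : ℝ × Ω, g t (leader pick b g (t + 1) y.1) ∂((expMeasure η).prod ν) =
      ∫ σ, g t (leader pick b g (t + 1) σ) ∂(expMeasure η) := by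
    simpa using integral_fun_fst (μ := expMeasure η) (ν := ν)
      (fun σ => g t (leader pick b g (t + 1) σ))
  have e2 : ∫ y : ℝ × Ω, L * D y.1 ∂((expMeasure η).prod ν) =
      L * ∫ σ, D σ ∂(expMeasure η) := by
    rw [← integral_const_mul]
    simpa using integral_fun_fst (μ := expMeasure η) (ν := ν) (fun σ => L * D σ)
  have e3 : ∫ y : ℝ × Ω, 2 * Γ y.2 ∂((expMeasure η).prod ν) = 2 * ∫ ω, Γ ω ∂ν := by
    rw [← integral_const_mul]
    simpa using integral_fun_snd (μ := expMeasure η) (ν := ν) (fun ω => 2 * Γ ω)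
  have e4 := integral_expMeasure_shift_le (a := 2 * L) hη (by positivity) hmb (fun σ => hb0 _)
    (fun σ => hB _)
  calc ∫ σ, g t (leader pick b g (t + 1) σ) ∂(expMeasure η)
      ≤ ∫ y, (g t (K y) + (L * D y.1 + 2 * Γ y.2)) ∂((expMeasure η).prod ν) := by
        rw [← e1]
        exact integral_mono i4 (i3.add i5) hpt
    _ = ∫ y, g t (K y) ∂((expMeasure η).prod ν) + (L * ∫ σ, D σ ∂(expMeasure η) +
        2 * ∫ ω, Γ ω ∂ν) := by
        rw [integral_add i3 i5, integral_add i1 i2, e2, e3]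
    _ ≤ _ := by
        rw [add_assoc]
        gcongr

/-- The regret of the leader in hindsight. -/
lemma cumReward_le_sum_integral_leader (hp : ArgmaxRule n pick) (hb0 : ∀ j, 0 ≤ b j) {B : ℝ}
    (hB : ∀ j, b j ≤ B) {η : ℝ} (hη : 0 < η) (T : ℕ) (k : Fin n) :
    cumReward g T k ≤ ∑ t ∈ Finset.range T,
      ∫ σ, g t (leader pick b g (t + 1) σ) ∂(expMeasure η) + B / η := by
  have := isProbabilityMeasure_expMeasure hη
  have hi t : Integrable (fun σ => g t (leader pick b g (t + 1) σ)) (expMeasure η) :=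
    integrable_comp_fin (measurable_leader hp (t + 1)) _
  have hi' : Integrable (fun σ => ∑ t ∈ Finset.range T, g t (leader pick b g (t + 1) σ))
    (expMeasure η) := integrable_finsetSum _ fun t _ => hi t
  have hid := (integrable_id_expMeasure hη).mul_const B
  calc cumReward g T k = ∫ _, cumReward g T k ∂(expMeasure η) := by simp
    _ ≤ ∫ σ, (∑ t ∈ Finset.range T, g t (leader pick b g (t + 1) σ) + σ * B) ∂(expMeasure η) := by
        refine integral_mono_ae (integrable_const _) (hi'.add hid) ?_
        filter_upwards [ae_nonneg_expMeasure η] with σ hσ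
        exact cumReward_le_sum_leader hp hb0 hB hσ T k
    _ = _ := by
        rw [integral_add hi' hid, integral_finsetSum _ fun t _ => hi t, integral_mul_const,
          integral_id_expMeasure hη]
        ring

end Leader

/-! ### Monte Carlo errors of the maximization oracle -/

lemma norm_smul_e₁ (d : ℕ) [NeZero d] (a : ℝ) : ‖a • e₁ d‖ = |a| := by
  simp [e₁, norm_smul]

lemma gridPoint_pos {B w : ℝ} (hw : 0 < w) (j : Fin (gridSize B w)) : 0 < gridPoint B w j := by
  unfold gridPoint; positivity

lemma gridPoint_le {B w : ℝ} (hB : 0 ≤ B) (hw : 0 < w) (j : Fin (gridSize B w)) :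
    gridPoint B w j ≤ B := by
  have h1 : ((j : ℕ) : ℝ) + 1 ≤ (gridSize B w : ℝ) := by exact_mod_cast j.2
  have h2 : (gridSize B w : ℝ) ≤ B / w := Nat.floor_le (by positivity)
  rw [gridPoint, ← le_div_iff₀ hw]
  exact h1.trans h2

instance (d : ℕ) [NeZero d] (B w : ℝ) (N₁ t : ℕ) : IsProbabilityMeasure (samplesLaw d B w N₁ t) := by
  unfold samplesLaw; infer_instance

/-- The Monte Carlo estimate of the cumulative risk of the previous estimators. -/
def riskEstimate {d : ℕ} [NeZero d] {B w : ℝ} {N₁ t : ℕ} (f : Fin t → E d → E d)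
    (X : Samples d B w N₁ t) (j : Fin (gridSize B w)) : ℝ :=
  ∑ i, (1 / (N₁ : ℝ)) * ∑ k, ‖f i (X i j k) - gridPoint B w j • e₁ d‖ ^ 2

lemma measurable_riskEstimate {d : ℕ} [NeZero d] {B w : ℝ} {N₁ t : ℕ} {f : Fin t → E d → E d}
    (hf : ∀ i, Measurable (f i)) :
    Measurable (riskEstimate f : Samples d B w N₁ t → Fin (gridSize B w) → ℝ) := by
  refine measurable_pi_lambda _ fun j => ?_
  unfold riskEstimate
  refine Finset.measurable_sum _ fun i _ => Measurable.const_mul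
    (Finset.measurable_sum _ fun k _ => ?_) _
  have : Measurable fun X : Samples d B w N₁ t => f i (X i j k) := (hf i).comp (by fun_prop)
  fun_prop

/-- Hoeffding's lemma for t N₁ independent terms in [0, 4B²/N₁]; the variance proxy equals 4B⁴t/N₁
when N₁ > 0. The grid point is fixed, so independence across the grid plays no role. -/
lemma hasSubgaussianMGF_riskEstimate {d : ℕ} [NeZero d] {B w : ℝ} (hB : 0 ≤ B) (hw : 0 < w)
    {N₁ t : ℕ} {f : Fin t → E d → E d} (hf : ∀ i, f i ∈ detEstimators d B)
    (j : Fin (gridSize B w)) :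
    HasSubgaussianMGF (fun X : Samples d B w N₁ t => riskEstimate f X j -
        ∑ i, ∑ _k : Fin N₁, 1 / (N₁ : ℝ) * realRisk (f i) (gridPoint B w j • e₁ d))
      (t * (N₁ * (‖4 * B ^ 2 / N₁ - 0‖₊ / 2) ^ 2)) (samplesLaw d B w N₁ t) := by
  set θ : E d := gridPoint B w j • e₁ d
  have hθ : ‖θ‖ ≤ B := by
    rw [norm_smul_e₁, abs_of_pos (gridPoint_pos hw j)]
    exact gridPoint_le hB hw j
  have hm (i : Fin t) : Measurable fun x => 1 / (N₁ : ℝ) * ‖f i x - θ‖ ^ 2 :=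
    (measurable_sq_dist (hf i) θ).const_mul _
  have h1 (i : Fin t) : HasSubgaussianMGF
      (fun x => 1 / (N₁ : ℝ) * ‖f i x - θ‖ ^ 2 - 1 / (N₁ : ℝ) * realRisk (f i) θ)
      ((‖4 * B ^ 2 / N₁ - 0‖₊ / 2) ^ 2) (normalLaw θ) := by
    have := hasSubgaussianMGF_of_mem_Icc (μ := normalLaw θ) (a := 0) (b := 4 * B ^ 2 / N₁)
      (hm i).aemeasurable (.of_forall fun x => ⟨by positivity, by
        rw [one_div_mul_eq_div]
        gcongr
        exact sq_dist_le (hf i) hθ x⟩)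
    rwa [integral_const_mul] at this
  have h2 (i : Fin t) := hasSubgaussianMGF_pi_sum (fun _ : Fin N₁ => normalLaw θ)
    (fun _ => (hm i).sub_const _) (fun _ => h1 i)
  have h3 (i : Fin t) : HasSubgaussianMGF (fun x : Fin (gridSize B w) → Fin N₁ → E d =>
      ∑ k, (1 / (N₁ : ℝ) * ‖f i (x j k) - θ‖ ^ 2 - 1 / (N₁ : ℝ) * realRisk (f i) θ))
      (N₁ * (‖4 * B ^ 2 / N₁ - 0‖₊ / 2) ^ 2)
      (Measure.pi fun j : Fin (gridSize B w) =>
        Measure.pi fun _ : Fin N₁ => normalLaw (gridPoint B w j • e₁ d)) := by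
    refine HasSubgaussianMGF.of_map (Y := fun x : Fin (gridSize B w) → Fin N₁ → E d => x j)
      (measurable_pi_apply j).aemeasurable (X := fun x : Fin N₁ → E d =>
        ∑ k, (1 / (N₁ : ℝ) * ‖f i (x k) - θ‖ ^ 2 - 1 / (N₁ : ℝ) * realRisk (f i) θ)) ?_
    rw [(measurePreserving_eval (fun j : Fin (gridSize B w) =>
        Measure.pi fun _ : Fin N₁ => normalLaw (gridPoint B w j • e₁ d)) j).map_eq]
    simpa using h2 i
  have h4 := hasSubgaussianMGF_pi_sum (fun _ : Fin t => Measure.pi fun j : Fin (gridSize B w) =>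
    Measure.pi fun _ : Fin N₁ => normalLaw (gridPoint B w j • e₁ d))
    (fun i => Finset.measurable_sum _ fun k _ =>
      ((hm i).comp (by fun_prop : Measurable fun x : Fin (gridSize B w) → Fin N₁ → E d =>
        x j k)).sub_const _) h3
  rw [Fintype.card_fin] at h4
  refine h4.congr (.of_forall fun X => ?_)
  simp only [riskEstimate, Function.comp_apply]
  rw [← Finset.sum_sub_distrib]
  refine Finset.sum_congr rfl fun i _ => ?_
  rw [Finset.sum_sub_distrib, Finset.mul_sum]

/-- The Monte Carlo errors have an integrable bound with a small expectation. -/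
lemma exists_bound_riskEstimate {d : ℕ} [NeZero d] {B w : ℝ} (hB : 0 ≤ B) (hw : 0 < w)
    (hn : 0 < gridSize B w) {N₁ t : ℕ} (hN : 0 < N₁) {f : Fin t → E d → E d}
    (hf : ∀ i, f i ∈ detEstimators d B) {l : ℝ} (hl : 0 < l) :
    ∃ Γ : Samples d B w N₁ t → ℝ, Integrable Γ (samplesLaw d B w N₁ t) ∧
      (∀ X j, |riskEstimate f X j - ∑ i, realRisk (f i) (gridPoint B w j • e₁ d)| ≤ Γ X) ∧
      ∫ X, Γ X ∂(samplesLaw d B w N₁ t) ≤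
        (Real.log (2 * gridSize B w) + 4 * B ^ 4 * t / N₁ * l ^ 2 / 2) / l := by
  have hN' : (0 : ℝ) < N₁ := by exact_mod_cast hN
  obtain ⟨Γ, h1, h2, h3⟩ := exists_integrable_bound_of_subgaussian hn
    (fun j => hasSubgaussianMGF_riskEstimate (N₁ := N₁) hB hw hf j) hl
  refine ⟨Γ, h1, fun X j => ?_, h3.trans (le_of_eq ?_)⟩
  · convert h2 X j using 4 with i
    simp only [Finset.sum_const, Finset.card_univ, Fintype.card_fin, nsmul_eq_mul]
    field_simp
  · congr 4
    have : (0 : ℝ) ≤ 4 * B ^ 2 / N₁ := by positivity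
    push_cast
    rw [sub_zero, Real.norm_of_nonneg this]
    field_simp
    ring

/-! ### Empirical frequencies -/

/-- The empirical frequency of `j` in a finite sample. -/
def freq {n N : ℕ} (k : Fin N → Fin n) (j : Fin n) : ℝ := ∑ s, 1 / (N : ℝ) * if k s = j then 1 else 0

/-- Hoeffding's inequality for N terms in [0, 1/N], whose sum has variance proxy 1/(4N), on both
sides. -/
lemma measure_freq_dev_le {n N : ℕ} (hN : 0 < N) {Ω : Type*} [MeasurableSpace Ω] (ν : Measure Ω)
    [IsProbabilityMeasure ν] {K : Ω → Fin n} (hK : Measurable K) (j : Fin n) {s : ℝ} (hs : 0 ≤ s) :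
    (Measure.pi fun _ : Fin N => ν) {y | s < |freq (fun i => K (y i)) j - ν.real (K ⁻¹' {j})|} ≤
      ENNReal.ofReal (2 * Real.exp (-(2 * N * s ^ 2))) := by
  have hN' : (0 : ℝ) < N := by exact_mod_cast hN
  set u : Ω → ℝ := fun y => 1 / (N : ℝ) * if K y = j then 1 else 0 with hu
  have hmu : Measurable u :=
    ((measurable_of_finite fun k : Fin n => if k = j then (1 : ℝ) else 0).comp hK).const_mul _
  have hint : ∫ y, u y ∂ν = 1 / (N : ℝ) * ν.real (K ⁻¹' {j}) := by
    rw [hu, integral_const_mul]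
    congr 1
    rw [← integral_indicator_one (hK (measurableSet_singleton j))]
    exact integral_congr_ae (.of_forall fun y => by simp [Set.indicator])
  have h1 : HasSubgaussianMGF (fun y => u y - ∫ y, u y ∂ν) ((‖1 / (N : ℝ) - 0‖₊ / 2) ^ 2) ν :=
    hasSubgaussianMGF_of_mem_Icc hmu.aemeasurable (.of_forall fun y => by
      simp only [hu]
      split_ifs <;> simp)
  have h2 := hasSubgaussianMGF_pi_sum (fun _ : Fin N => ν) (fun _ => hmu.sub_const _) (fun _ => h1)
  rw [Fintype.card_fin] at h2
  have hc : (((N : NNReal) * (‖1 / (N : ℝ) - 0‖₊ / 2) ^ 2 : NNReal) : ℝ) = 1 / (4 * N) := by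
    push_cast
    rw [sub_zero, Real.norm_of_nonneg (by positivity)]
    field_simp
    norm_num
  have hexp : -s ^ 2 / (2 * (1 / (4 * (N : ℝ)))) = -(2 * N * s ^ 2) := by
    field_simp
    norm_num
  have hsum (y : Fin N → Ω) : ∑ i, (u (y i) - ∫ y, u y ∂ν) =
      freq (fun i => K (y i)) j - ν.real (K ⁻¹' {j}) := by
    rw [Finset.sum_sub_distrib, hint,
      show freq (fun i => K (y i)) j = ∑ i, u (y i) from rfl]
    simp only [Finset.sum_const, Finset.card_univ, Fintype.card_fin, nsmul_eq_mul]
    field_simp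
  have b1 := h2.measure_ge_le hs
  have b2 := h2.neg.measure_ge_le hs
  rw [hc, hexp] at b1 b2
  simp only [Pi.neg_apply, hsum] at b1 b2
  have hsub : {y : Fin N → Ω | s < |freq (fun i => K (y i)) j - ν.real (K ⁻¹' {j})|} ⊆
      {y | s ≤ freq (fun i => K (y i)) j - ν.real (K ⁻¹' {j})} ∪
      {y | s ≤ -(freq (fun i => K (y i)) j - ν.real (K ⁻¹' {j}))} := by
    intro y hy
    rcases lt_abs.1 (show s < |freq (fun i => K (y i)) j - ν.real (K ⁻¹' {j})| from hy) with h | h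
    · exact .inl h.le
    · exact .inr h.le
  rw [ENNReal.le_ofReal_iff_toReal_le (measure_ne_top _ _) (by positivity)]
  calc _ ≤ (Measure.pi fun _ : Fin N => ν).real _ := measureReal_mono hsub
    _ ≤ _ := measureReal_union_le _ _
    _ ≤ _ := by linarith

/-- A set is small in a product space if its sections in one direction are. -/
lemma pi_measure_le_of_section {ι : Type*} [Fintype ι] [DecidableEq ι] {X : ι → Type*}
    [∀ i, MeasurableSpace (X i)] (μ : ∀ i, Measure (X i)) [∀ i, IsProbabilityMeasure (μ i)]
    {S : Set (∀ i, X i)} (hS : MeasurableSet S) (t : ι) {c : ℝ≥0∞}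
    (h : ∀ ω, μ t {y | Function.update ω t y ∈ S} ≤ c) : Measure.pi μ S ≤ c := by
  have hm : Measurable (S.indicator fun _ => (1 : ℝ≥0∞)) := measurable_const.indicator hS
  have hconst : ∫⁻ _, c ∂(Measure.pi μ) = c := by simp
  rw [← lintegral_indicator_one hS, ← hconst]
  refine lintegral_le_of_lmarginal_le {t} hm measurable_const fun ω => ?_
  rw [lmarginal_singleton, lmarginal_singleton]
  have hS' : MeasurableSet {y | Function.update ω t y ∈ S} := hS.preimage (measurable_update ω)
  calc _ = ∫⁻ y, {y | Function.update ω t y ∈ S}.indicator 1 y ∂(μ t) := rfl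
    _ ≤ c := by rw [lintegral_indicator_one hS']; exact h ω
    _ = _ := by simp

/-! ### The rounds of a run -/

section Run

variable {d : ℕ} [NeZero d] {B w : ℝ} {N₁ N₂ T : ℕ}
  {pick : (Fin (gridSize B w) → ℝ) → Fin (gridSize B w)}

/-- The index of the grid point that the maximization oracle returns, given the indices drawn in
the previous rounds. -/
def oracleIndex (d : ℕ) [NeZero d] (N₁ : ℕ) {t : ℕ}
    (pick : (Fin (gridSize B w) → ℝ) → Fin (gridSize B w))
    (h : Fin t → Fin N₂ → Fin (gridSize B w)) (y : ℝ × Samples d B w N₁ t) : Fin (gridSize B w) :=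
  pick (objective (fun i => minOracle fun s => gridPoint B w (h i s)) y.1 y.2)

/-- The indices of the radii drawn in round `t`. -/
def roundIndex (pick : (Fin (gridSize B w) → ℝ) → Fin (gridSize B w)) (ω : Seed d B w N₁ N₂ T)
    (t : Fin T) (s : Fin N₂) : Fin (gridSize B w) :=
  pick (objective (fun i : Fin t => minOracle (radii pick ω ⟨i, i.2.trans t.2⟩)) (ω t s).1 (ω t s).2)

/-- The indices of the radii drawn before round `t`. -/
def history (pick : (Fin (gridSize B w) → ℝ) → Fin (gridSize B w)) (ω : Seed d B w N₁ N₂ T)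
    (t : Fin T) (i : Fin t) : Fin N₂ → Fin (gridSize B w) :=
  roundIndex pick ω ⟨i, i.2.trans t.2⟩

lemma radii_eq (ω : Seed d B w N₁ N₂ T) (t : Fin T) :
    radii pick ω t = fun s => gridPoint B w (roundIndex pick ω t s) := by
  ext s
  rw [radii]
  rfl

/-- Separates the past, which takes finitely many values, from the fresh randomness of the draw.
Measurability and conditioning both rest on this form. -/
lemma roundIndex_eq (ω : Seed d B w N₁ N₂ T) (t : Fin T) (s : Fin N₂) :
    roundIndex pick ω t s = oracleIndex d N₁ pick (history pick ω t) (ω t s) := by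
  unfold roundIndex oracleIndex
  simp only [radii_eq]
  rfl

lemma iterate_eq (ω : Seed d B w N₁ N₂ T) (t : Fin T) :
    iterate pick ω t = minOracle fun s => gridPoint B w (roundIndex pick ω t s) := by
  rw [iterate, radii_eq]

lemma minOracle_gridPoint_mem (hB : 0 ≤ B) (hw : 0 < w) [NeZero N₂]
    (k : Fin N₂ → Fin (gridSize B w)) :
    (minOracle (fun s => gridPoint B w (k s)) : E d → E d) ∈ detEstimators d B :=
  minOracle_mem_detEstimators (fun _ => gridPoint_pos hw _) (fun _ => gridPoint_le hB hw _)

lemma measurable_oracleIndex (hp : ArgmaxRule (gridSize B w) pick) (hB : 0 ≤ B) (hw : 0 < w)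
    [NeZero N₂] {t : ℕ} (h : Fin t → Fin N₂ → Fin (gridSize B w)) :
    Measurable (oracleIndex d N₁ pick h) := by
  refine hp.measurable.comp (measurable_pi_lambda _ fun j => ?_)
  have h1 : Measurable fun y : ℝ × Samples d B w N₁ t =>
      riskEstimate (fun i => minOracle fun s => gridPoint B w (h i s)) y.2 j :=
    (measurable_pi_apply j).comp ((measurable_riskEstimate fun i =>
      (minOracle_gridPoint_mem hB hw (h i)).1).comp measurable_snd)
  exact h1.add (measurable_fst.mul_const _)

lemma measurable_roundIndex (hp : ArgmaxRule (gridSize B w) pick) (hB : 0 ≤ B) (hw : 0 < w)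
    [NeZero N₂] (t : Fin T) :
    Measurable fun ω : Seed d B w N₁ N₂ T => roundIndex pick ω t := by
  induction t using WellFoundedLT.induction with
  | _ t ih =>
    refine measurable_pi_lambda _ fun s => ?_
    simp_rw [roundIndex_eq]
    have h1 : Measurable fun ω : Seed d B w N₁ N₂ T => history pick ω t :=
      measurable_pi_lambda _ fun i => ih ⟨i, i.2.trans t.2⟩ i.2
    have h2 : Measurable fun ω : Seed d B w N₁ N₂ T => ω t s :=
      (measurable_pi_apply s).comp (measurable_pi_apply t)
    -- The space of histories is finite, so joint measurability reduces to each frozen history.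
    have h3 : Measurable fun p : (Fin t → Fin N₂ → Fin (gridSize B w)) ×
        (ℝ × Samples d B w N₁ t) => oracleIndex d N₁ pick p.1 p.2 :=
      measurable_from_prod_countable_right fun h => measurable_oracleIndex hp hB hw h
    have h4 : Measurable fun ω : Seed d B w N₁ N₂ T => (history pick ω t, ω t s) := h1.prodMk h2
    simpa only [Function.comp_def] using h3.comp h4

lemma measurable_history (hp : ArgmaxRule (gridSize B w) pick) (hB : 0 ≤ B) (hw : 0 < w)
    [NeZero N₂] (t : Fin T) :
    Measurable fun ω : Seed d B w N₁ N₂ T => history pick ω t :=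
  measurable_pi_lambda _ fun _ => measurable_roundIndex hp hB hw _

/-- Earlier rounds never read `ω t`. This is what makes the draws of round t independent of their
history. -/
lemma roundIndex_update (ω : Seed d B w N₁ N₂ T) (t : Fin T)
    (y : Fin N₂ → ℝ × Samples d B w N₁ t) (i : Fin T) (hi : i < t) :
    roundIndex pick (Function.update ω t y) i = roundIndex pick ω i := by
  obtain ⟨m, hm⟩ := i
  induction m using Nat.strong_induction_on with
  | _ m ih =>
    ext1 s
    rw [roundIndex_eq, roundIndex_eq, Function.update_of_ne hi.ne]
    congr 1
    ext1 k
    exact ih k k.2 _ (lt_trans (by exact k.2) hi)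

lemma history_update (ω : Seed d B w N₁ N₂ T) (t : Fin T)
    (y : Fin N₂ → ℝ × Samples d B w N₁ t) :
    history pick (Function.update ω t y) t = history pick ω t := by
  ext1 i
  exact roundIndex_update ω t y _ i.2

/-- The law `P_t` of the maximization oracle, as a probability vector. -/
def oracleProb (d : ℕ) [NeZero d] (N₁ : ℕ) (η : ℝ) {t : ℕ}
    (pick : (Fin (gridSize B w) → ℝ) → Fin (gridSize B w))
    (h : Fin t → Fin N₂ → Fin (gridSize B w)) (j : Fin (gridSize B w)) : ℝ :=
  ((expMeasure η).prod (samplesLaw d B w N₁ t)).real (oracleIndex d N₁ pick h ⁻¹' {j})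

/-- The runs in which the empirical frequency of `j` in round `t` is off by more than `s`. -/
def deviationSet (pick : (Fin (gridSize B w) → ℝ) → Fin (gridSize B w)) (η s : ℝ) (t : Fin T)
    (j : Fin (gridSize B w)) : Set (Seed d B w N₁ N₂ T) :=
  {ω | s < |freq (roundIndex pick ω t) j - oracleProb d N₁ η pick (history pick ω t) j|}

/-- Freeze the seeds of all other rounds: the history is then constant and the N₂ draws are
independent with law P_t, so Hoeffding's inequality bounds every section. -/
lemma seedLaw_deviationSet_le (hp : ArgmaxRule (gridSize B w) pick) (hB : 0 ≤ B) (hw : 0 < w)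
    [NeZero N₂] {η s : ℝ} (hη : 0 < η) (hs : 0 ≤ s) (t : Fin T) (j : Fin (gridSize B w)) :
    seedLaw d B η w N₁ N₂ T (deviationSet pick η s t j) ≤
      ENNReal.ofReal (2 * Real.exp (-(2 * N₂ * s ^ 2))) := by
  have := isProbabilityMeasure_expMeasure hη
  refine pi_measure_le_of_section _ ?_ t fun ω => ?_
  · have h1 : Measurable fun ω : Seed d B w N₁ N₂ T => freq (roundIndex pick ω t) j :=
      (measurable_of_finite fun k : Fin N₂ → Fin (gridSize B w) => freq k j).comp
        (measurable_roundIndex hp hB hw t)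
    have h2 : Measurable fun ω : Seed d B w N₁ N₂ T =>
        oracleProb d N₁ η pick (history pick ω t) j :=
      (measurable_of_finite fun h : Fin t → Fin N₂ → Fin (gridSize B w) =>
        oracleProb d N₁ η pick h j).comp (measurable_history hp hB hw t)
    exact measurableSet_lt measurable_const (by fun_prop)
  · have hset : {y | Function.update ω t y ∈ deviationSet pick η s t j} =
        {y | s < |freq (fun i => oracleIndex d N₁ pick (history pick ω t) (y i)) j -
          ((expMeasure η).prod (samplesLaw d B w N₁ t)).real
            (oracleIndex d N₁ pick (history pick ω t) ⁻¹' {j})|} := by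
      ext y
      simp only [deviationSet, Set.mem_ofPred_eq, history_update, oracleProb]
      have : roundIndex pick (Function.update ω t y) t =
          fun i => oracleIndex d N₁ pick (history pick ω t) (y i) := by
        ext1 i
        rw [roundIndex_eq, history_update, Function.update_self]
      rw [this]
    rw [hset]
    exact measure_freq_dev_le (Nat.pos_of_ne_zero (NeZero.ne N₂))
      ((expMeasure η).prod (samplesLaw d B w N₁ t))
      (measurable_oracleIndex hp hB hw (history pick ω t)) j hs

lemma seedLaw_iUnion_deviationSet_le (hp : ArgmaxRule (gridSize B w) pick) (hB : 0 ≤ B)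
    (hw : 0 < w) [NeZero N₂] {η s : ℝ} (hη : 0 < η) (hs : 0 ≤ s) :
    seedLaw d B η w N₁ N₂ T (⋃ (t : Fin T) (j : Fin (gridSize B w)), deviationSet pick η s t j) ≤
      ENNReal.ofReal (T * gridSize B w * (2 * Real.exp (-(2 * N₂ * s ^ 2)))) := by
  calc _ ≤ ∑ t : Fin T, seedLaw d B η w N₁ N₂ T
        (⋃ (j : Fin (gridSize B w)), deviationSet pick η s t j) := measure_iUnion_fintype_le _ _
    _ ≤ ∑ t : Fin T, ∑ j : Fin (gridSize B w),
        seedLaw d B η w N₁ N₂ T (deviationSet pick η s t j) :=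
        Finset.sum_le_sum fun t _ => measure_iUnion_fintype_le _ _
    _ ≤ ∑ _t : Fin T, ∑ _j : Fin (gridSize B w),
        ENNReal.ofReal (2 * Real.exp (-(2 * N₂ * s ^ 2))) :=
        Finset.sum_le_sum fun t _ => Finset.sum_le_sum fun j _ =>
          seedLaw_deviationSet_le hp hB hw hη hs t j
    _ = _ := by
        simp only [Finset.sum_const, Finset.card_univ, Fintype.card_fin, nsmul_eq_mul]
        rw [ENNReal.ofReal_mul (p := T * gridSize B w) (by positivity),
          ENNReal.ofReal_mul (p := (T : ℝ)) (by positivity), ENNReal.ofReal_natCast, ENNReal.ofReal_natCast]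
        simp only [mul_assoc]

end Run

/-! ### The value of a run -/

section Value

variable {d : ℕ} [NeZero d] {B w : ℝ} {N₁ N₂ T : ℕ}
  {pick : (Fin (gridSize B w) → ℝ) → Fin (gridSize B w)}

/-- The risk of the estimator of round `t` at the `j`-th grid point. -/
def gridRisk (pick : (Fin (gridSize B w) → ℝ) → Fin (gridSize B w)) (ω : Seed d B w N₁ N₂ T)
    (t : Fin T) (j : Fin (gridSize B w)) : ℝ :=
  realRisk (iterate pick ω t) (gridPoint B w j • e₁ d)

/-- The integrated risk of the estimator of round `t` under the radial extension of the empirical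
distribution of the radii of that round. -/
def roundValue (pick : (Fin (gridSize B w) → ℝ) → Fin (gridSize B w)) (ω : Seed d B w N₁ N₂ T)
    (t : Fin T) : ℝ := 1 / (N₂ : ℝ) * ∑ s, gridRisk pick ω t (roundIndex pick ω t s)

lemma iterate_mem (hB : 0 ≤ B) (hw : 0 < w) [NeZero N₂] (ω : Seed d B w N₁ N₂ T) (t : Fin T) :
    iterate pick ω t ∈ detEstimators d B := by
  rw [iterate_eq]
  exact minOracle_gridPoint_mem hB hw _

lemma norm_gridPoint_smul_le (hB : 0 ≤ B) (hw : 0 < w) (j : Fin (gridSize B w)) :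
    ‖gridPoint B w j • e₁ d‖ ≤ B := by
  rw [norm_smul_e₁, abs_of_pos (gridPoint_pos hw j)]
  exact gridPoint_le hB hw j

lemma gridRisk_nonneg (ω : Seed d B w N₁ N₂ T) (t : Fin T) (j : Fin (gridSize B w)) :
    0 ≤ gridRisk pick ω t j := realRisk_nonneg _ _

lemma gridRisk_le (hB : 0 ≤ B) (hw : 0 < w) [NeZero N₂] (ω : Seed d B w N₁ N₂ T) (t : Fin T)
    (j : Fin (gridSize B w)) : gridRisk pick ω t j ≤ 4 * B ^ 2 :=
  realRisk_le (iterate_mem hB hw ω t) (norm_gridPoint_smul_le hB hw j)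

lemma roundValue_nonneg (ω : Seed d B w N₁ N₂ T) (t : Fin T) : 0 ≤ roundValue pick ω t :=
  mul_nonneg (by positivity) (Finset.sum_nonneg fun _ _ => gridRisk_nonneg _ _ _)

lemma roundValue_eq_sum_freq (ω : Seed d B w N₁ N₂ T) (t : Fin T) :
    roundValue pick ω t = ∑ j, freq (roundIndex pick ω t) j * gridRisk pick ω t j := by
  simp only [roundValue, freq, Finset.sum_mul]
  rw [Finset.sum_comm, Finset.mul_sum]
  refine Finset.sum_congr rfl fun s _ => ?_
  simp

/-- The risk is constant on spheres, so its average over the sphere of radius b is its value at b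
e₁. -/
lemma integratedRisk_iterate (hB : 0 ≤ B) (hw : 0 < w) [NeZero N₂] (ω : Seed d B w N₁ N₂ T)
    (t : Fin T) :
    integratedRisk (iterate pick ω t) (radialExtension d (empirical (radii pick ω t))) =
      ENNReal.ofReal (roundValue pick ω t) := by
  have hmem := iterate_mem (pick := pick) hB hw ω t
  have hN : (0 : ℝ) < N₂ := by exact_mod_cast Nat.pos_of_ne_zero (NeZero.ne N₂)
  rw [integratedRisk, lintegral_radialExtension _ (measurable_risk hmem.1), lintegral_empirical,
    roundValue, ENNReal.ofReal_mul (by positivity), one_div, ENNReal.ofReal_inv_of_pos hN,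
    ENNReal.ofReal_natCast, ENNReal.ofReal_sum_of_nonneg fun _ _ => gridRisk_nonneg _ _ _]
  congr 1
  refine Finset.sum_congr rfl fun s _ => ?_
  have h1 (u : Metric.sphere (0 : E d) 1) : risk (iterate pick ω t) (radii pick ω t s • (u : E d)) =
      ENNReal.ofReal (gridRisk pick ω t (roundIndex pick ω t s)) := by
    rw [gridRisk, ← risk_eq_ofReal hmem (norm_gridPoint_smul_le hB hw _)]
    refine risk_minOracle_eq hmem.1 ?_
    rw [radii_eq, norm_smul_e₁, norm_smul]
    simp
  simp [h1]

instance isProbabilityMeasure_avgPrior [NeZero N₂] [NeZero T] (ω : Seed d B w N₁ N₂ T) :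
    IsProbabilityMeasure (avgPrior pick ω) := by
  refine ⟨?_⟩
  have hT : (T : ℝ≥0∞) ≠ 0 := by exact_mod_cast NeZero.ne T
  simp [avgPrior, ENNReal.inv_mul_cancel hT]

instance isProbabilityMeasure_lfPrior [NeZero N₂] [NeZero T] (ω : Seed d B w N₁ N₂ T) :
    IsProbabilityMeasure (lfPrior pick ω) := isProbabilityMeasure_radialExtension _

lemma lintegral_lfPrior [NeZero N₂] [NeZero T] (ω : Seed d B w N₁ N₂ T) {g : E d → ℝ≥0∞}
    (hg : Measurable g) :
    ∫⁻ θ, g θ ∂(lfPrior pick ω) = (T : ℝ≥0∞)⁻¹ *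
      ∑ t, ∫⁻ θ, g θ ∂(radialExtension d (empirical (radii pick ω t))) := by
  rw [lfPrior, lintegral_radialExtension _ hg, avgPrior, lintegral_smul_measure,
    lintegral_finsetSum_measure, smul_eq_mul]
  congr 1
  exact Finset.sum_congr rfl fun t _ => (lintegral_radialExtension _ hg).symm

lemma lfPrior_compl_paramSpace (hB : 0 ≤ B) (hw : 0 < w) [NeZero N₂] [NeZero T]
    (ω : Seed d B w N₁ N₂ T) : lfPrior pick ω (paramSpace d B)ᶜ = 0 := by
  have hs : MeasurableSet (paramSpace d B)ᶜ := Metric.isClosed_closedBall.measurableSet.compl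
  rw [← lintegral_indicator_one hs, lintegral_lfPrior ω (measurable_one.indicator hs)]
  simp only [lintegral_indicator_one hs]
  rw [Finset.sum_eq_zero, mul_zero]
  intro t _
  have := radialExtension_ae_norm_le (d := d) (b := radii pick ω t) (B := B) fun s => by
    rw [radii_eq, abs_of_pos (gridPoint_pos hw _)]
    exact gridPoint_le hB hw _
  rw [ae_iff] at this
  convert this using 2
  ext θ
  simp [paramSpace]

/-- The values of the rounds bound the Bayes risk of the averaged prior from below. -/
lemma ofReal_avg_roundValue_le_bayesRisk (hB : 0 ≤ B) (hw : 0 < w) [NeZero N₂] [NeZero T]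
    (ω : Seed d B w N₁ N₂ T) :
    ENNReal.ofReal (1 / (T : ℝ) * ∑ t, roundValue pick ω t) ≤ bayesRisk d B (lfPrior pick ω) := by
  have hT : (0 : ℝ) < T := by exact_mod_cast Nat.pos_of_ne_zero (NeZero.ne T)
  refine le_iInf₂ fun f hf => ?_
  rw [integratedRisk, lintegral_lfPrior ω (measurable_risk hf.1), ENNReal.ofReal_mul (by positivity),
    one_div, ENNReal.ofReal_inv_of_pos hT, ENNReal.ofReal_natCast,
    ENNReal.ofReal_sum_of_nonneg fun _ _ => roundValue_nonneg _ _]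
  -- The prior is a mixture of the priors of the rounds; on each of them `f` does no better than
  -- that round's own Bayes estimator.
  gcongr with t _
  rw [← integratedRisk_iterate hB hw, iterate]
  exact integratedRisk_minOracle_le (B := B)
    (fun s => by rw [radii_eq]; exact gridPoint_pos hw _)
    (fun s => by rw [radii_eq]; exact gridPoint_le hB hw _) hf.1

lemma avgEstimator_mem (hB : 0 ≤ B) (hw : 0 < w) [NeZero N₂] [NeZero T]
    (ω : Seed d B w N₁ N₂ T) : avgEstimator pick ω ∈ detEstimators d B := by
  have hT : (0 : ℝ) < T := by exact_mod_cast Nat.pos_of_ne_zero (NeZero.ne T)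
  have hmem t := iterate_mem (pick := pick) hB hw ω t
  refine ⟨?_, fun x => ?_⟩
  · exact (Finset.measurable_sum _ fun t _ => (hmem t).1).const_smul (1 / (T : ℝ))
  · have h1 (t) : ‖iterate pick ω t x‖ ≤ B := by simpa [paramSpace] using (hmem t).2 x
    simp only [paramSpace, mem_closedBall_zero_iff, avgEstimator]
    rw [norm_smul, Real.norm_of_nonneg (by positivity), one_div, inv_mul_le_iff₀ hT]
    calc _ ≤ ∑ t, ‖iterate pick ω t x‖ := norm_sum_le _ _
      _ ≤ ∑ _t : Fin T, B := Finset.sum_le_sum fun t _ => h1 t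
      _ = _ := by simp

/-- The risk of the averaged estimator is at most the average of the risks. -/
lemma realRisk_avgEstimator_le (hB : 0 ≤ B) (hw : 0 < w) [NeZero N₂] [NeZero T]
    (ω : Seed d B w N₁ N₂ T) {θ : E d} (hθ : ‖θ‖ ≤ B) :
    realRisk (avgEstimator pick ω) θ ≤ 1 / (T : ℝ) * ∑ t, realRisk (iterate pick ω t) θ := by
  have hT : (0 : ℝ) < T := by exact_mod_cast Nat.pos_of_ne_zero (NeZero.ne T)
  have hi t := integrable_sq_dist (iterate_mem (pick := pick) hB hw ω t) hθ θ
  have hconv : ConvexOn ℝ Set.univ fun v : E d => ‖v‖ ^ 2 :=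
    (convexOn_norm convex_univ).pow (fun _ _ => norm_nonneg _) 2
  calc realRisk (avgEstimator pick ω) θ
      ≤ ∫ x, 1 / (T : ℝ) * ∑ t, ‖iterate pick ω t x - θ‖ ^ 2 ∂(normalLaw θ) := by
        refine integral_mono (integrable_sq_dist (avgEstimator_mem hB hw ω) hθ θ)
          ((integrable_finsetSum _ fun t _ => hi t).const_mul _) fun x => ?_
        have h1 := hconv.map_sum_le (t := Finset.univ) (w := fun _ : Fin T => 1 / (T : ℝ))
          (p := fun t => iterate pick ω t x - θ) (fun _ _ => by positivity)
          (by simp [hT.ne']) (fun _ _ => Set.mem_univ _)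
        simp only [smul_eq_mul, ← Finset.mul_sum, ← Finset.smul_sum, Finset.sum_sub_distrib,
          smul_sub] at h1
        have h2 : (1 / (T : ℝ)) • ∑ _t : Fin T, θ = θ := by
          simp only [Finset.sum_const, Finset.card_univ, Fintype.card_fin]
          rw [← Nat.cast_smul_eq_nsmul ℝ, smul_smul, one_div_mul_cancel hT.ne', one_smul]
        rw [h2] at h1
        exact h1
    _ = _ := by
        rw [integral_const_mul, integral_finsetSum _ fun t _ => hi t]
        rfl

/-- Every radius is close to the grid. -/
lemma exists_gridPoint_near (hw : 0 < w) (hn : 0 < gridSize B w) {r : ℝ} (h0 : 0 ≤ r)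
    (hr : r ≤ B) : ∃ j : Fin (gridSize B w), |r - gridPoint B w j| ≤ w := by
  -- The grid starts at w, not at 0, so radii below w are matched with the first point; the others
  -- are rounded down.
  rcases lt_or_ge r w with h | h
  · refine ⟨⟨0, hn⟩, ?_⟩
    simp only [gridPoint, Nat.cast_zero, zero_add, one_mul]
    rw [abs_le]
    constructor <;> linarith
  · have h1 : 1 ≤ ⌊r / w⌋₊ := Nat.le_floor (by rw [Nat.cast_one, one_le_div hw]; exact h)
    have h2 : ⌊r / w⌋₊ ≤ gridSize B w := Nat.floor_le_floor (by gcongr)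
    refine ⟨⟨⌊r / w⌋₊ - 1, by omega⟩, ?_⟩
    have h3 : ((⌊r / w⌋₊ - 1 : ℕ) : ℝ) + 1 = ⌊r / w⌋₊ := by
      rw [Nat.cast_sub h1]; simp
    simp only [gridPoint, h3]
    have h4 : (⌊r / w⌋₊ : ℝ) ≤ r / w := Nat.floor_le (by positivity)
    have h5 : r / w < ⌊r / w⌋₊ + 1 := Nat.lt_floor_add_one _
    rw [le_div_iff₀ hw] at h4
    rw [div_lt_iff₀ hw] at h5
    rw [abs_le]
    constructor <;> nlinarith

lemma integral_comp_fin_eq {Ω : Type*} [MeasurableSpace Ω] {ν : Measure Ω} [IsFiniteMeasure ν]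
    {n : ℕ} {K : Ω → Fin n} (hK : Measurable K) (v : Fin n → ℝ) :
    ∫ y, v (K y) ∂ν = ∑ j, ν.real (K ⁻¹' {j}) * v j := by
  have h1 (y : Ω) : v (K y) = ∑ j, (K ⁻¹' {j}).indicator (fun _ => v j) y := by
    simp [Set.indicator]
  simp_rw [h1]
  rw [integral_finsetSum _ fun j _ =>
    (integrable_const (v j)).indicator (hK (measurableSet_singleton j))]
  refine Finset.sum_congr rfl fun j _ => ?_
  rw [integral_indicator_const _ (hK (measurableSet_singleton j)), smul_eq_mul]

/-- The regret of a run whose empirical frequencies are accurate. -/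
lemma sum_gridRisk_le (hp : ArgmaxRule (gridSize B w) pick) (hB : 0 < B) (hw : 0 < w)
    [NeZero N₂] (hN₁ : 0 < N₁) {η s l : ℝ} (hη : 0 < η) (hs : 0 ≤ s) (hl : 0 < l)
    {ω : Seed d B w N₁ N₂ T} (hω : ∀ t j, ω ∉ deviationSet pick η s t j)
    (k : Fin (gridSize B w)) :
    ∑ t, gridRisk pick ω t k ≤ ∑ t, roundValue pick ω t + B / η + T *
      (gridSize B w * (s * (4 * B ^ 2)) +
        8 * B * (B + 1) * (B * (Real.exp (η * (2 * (8 * B * (B + 1)))) -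
          Real.exp (-(η * (2 * (8 * B * (B + 1))))))) +
        2 * ((Real.log (2 * gridSize B w) + 4 * B ^ 4 * T / N₁ * l ^ 2 / 2) / l)) := by
  have := isProbabilityMeasure_expMeasure hη
  have hn : 0 < gridSize B w := k.pos
  set L : ℝ := 8 * B * (B + 1) with hL
  have hLpos : 0 < L := by positivity
  -- The run is fixed, so the rewards are a fixed sequence, continued by 0 after round T. The
  -- perturbation integrated below is a fresh variable, not a coordinate of the run.
  set g : ℕ → Fin (gridSize B w) → ℝ := fun t j =>
    if h : t < T then gridRisk pick ω ⟨t, h⟩ j else 0 with hg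
  have hgt (t : Fin T) (j) : g t j = gridRisk pick ω t j := by simp [hg]
  have hb0 (j : Fin (gridSize B w)) : 0 ≤ gridPoint B w j := (gridPoint_pos hw j).le
  have hbB (j : Fin (gridSize B w)) : gridPoint B w j ≤ B := gridPoint_le hB.le hw j
  have hcum : cumReward g T k = ∑ t, gridRisk pick ω t k := by
    rw [cumReward, Finset.sum_range]
    exact Finset.sum_congr rfl fun t _ => hgt t k
  have hround (t : Fin T) :
      ∫ σ, g t (leader pick (gridPoint B w) g (t + 1) σ) ∂(expMeasure η) ≤
      roundValue pick ω t + (gridSize B w * (s * (4 * B ^ 2)) +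
        L * (B * (Real.exp (η * (2 * L)) - Real.exp (-(η * (2 * L))))) +
        2 * ((Real.log (2 * gridSize B w) + 4 * B ^ 4 * T / N₁ * l ^ 2 / 2) / l)) := by
    set f : Fin t → E d → E d := fun i => minOracle fun s => gridPoint B w (history pick ω t i s)
    have hf i : f i ∈ detEstimators d B := minOracle_gridPoint_mem hB.le hw _
    obtain ⟨Γ, hΓi, hΓ, hΓE⟩ := exists_bound_riskEstimate hB.le hw hn hN₁ hf hl
    have hlip (j k : Fin (gridSize B w)) :
        g t j - g t k ≤ L * |gridPoint B w j - gridPoint B w k| := by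
      rw [hgt, hgt]
      have := realRisk_sub_le (iterate_mem (pick := pick) hB.le hw ω t)
        (norm_gridPoint_smul_le (d := d) hB.le hw j) (norm_gridPoint_smul_le hB.le hw k)
      rwa [← sub_smul, norm_smul_e₁] at this
    have hcumt (j : Fin (gridSize B w)) : cumReward g t j =
        ∑ i, realRisk (f i) (gridPoint B w j • e₁ d) := by
      rw [cumReward, Finset.sum_range]
      refine Finset.sum_congr rfl fun i _ => ?_
      have h1 : (i : ℕ) < T := i.2.trans t.2
      rw [hgt ⟨i, h1⟩, gridRisk, iterate_eq]
      rfl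
    have h1 := integral_leader_le (g := g) (t := t) hp hb0 hbB hLpos hη hlip
      (measurable_riskEstimate fun i => (hf i).1) hΓi (fun X j => by rw [hcumt]; exact hΓ X j)
    -- Passing from P_t to the empirical frequencies costs s per grid point, times the bound 4B² of
    -- the risk.
    have h2 : ∫ y, g t (pick fun j => riskEstimate f y.2 j + y.1 * gridPoint B w j)
        ∂((expMeasure η).prod (samplesLaw d B w N₁ t)) ≤
        roundValue pick ω t + gridSize B w * (s * (4 * B ^ 2)) := by
      have h3 := integral_comp_fin_eq (ν := (expMeasure η).prod (samplesLaw d B w N₁ t))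
        (measurable_oracleIndex (N₁ := N₁) (d := d) hp hB.le hw (history pick ω t)) (g t)
      calc _ = _ := h3
        _ ≤ ∑ j, (freq (roundIndex pick ω t) j * gridRisk pick ω t j + s * (4 * B ^ 2)) := by
            refine Finset.sum_le_sum fun j _ => ?_
            rw [hgt]
            have h4 : |freq (roundIndex pick ω t) j -
                oracleProb d N₁ η pick (history pick ω t) j| ≤ s := not_lt.1 (hω t j)
            have h5 := (abs_le.1 h4).1
            have h6 := gridRisk_nonneg (pick := pick) ω t j
            have h7 := gridRisk_le (pick := pick) hB.le hw ω t j
            change oracleProb d N₁ η pick (history pick ω t) j * gridRisk pick ω t j ≤ _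
            nlinarith [mul_le_mul_of_nonneg_left h7 hs]
        _ = _ := by
            rw [Finset.sum_add_distrib, ← roundValue_eq_sum_freq]
            simp
    have h3 : (Real.log (2 * gridSize B w) + 4 * B ^ 4 * (t : ℕ) / N₁ * l ^ 2 / 2) / l ≤
        (Real.log (2 * gridSize B w) + 4 * B ^ 4 * T / N₁ * l ^ 2 / 2) / l := by
      have : ((t : ℕ) : ℝ) ≤ T := by exact_mod_cast t.2.le
      gcongr
    linarith
  have h1 := cumReward_le_sum_integral_leader (g := g) hp hb0 hbB hη T k
  rw [hcum, Finset.sum_range] at h1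
  refine h1.trans ?_
  have h2 := Finset.sum_le_sum fun (t : Fin T) (_ : t ∈ Finset.univ) => hround t
  rw [Finset.sum_add_distrib] at h2
  simp only [Finset.sum_const, Finset.card_univ, Fintype.card_fin, nsmul_eq_mul] at h2
  linarith

/-- The gap between the worst-case risk of the averaged estimator and the Bayes risk of the averaged
prior, in a run whose empirical frequencies are accurate. -/
lemma worstCaseRisk_avgEstimator_le (hp : ArgmaxRule (gridSize B w) pick) (hB : 0 < B) (hw : 0 < w)
    (hn : 0 < gridSize B w) [NeZero N₂] [NeZero T] (hN₁ : 0 < N₁) {η s l : ℝ} (hη : 0 < η)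
    (hs : 0 ≤ s) (hl : 0 < l) {ω : Seed d B w N₁ N₂ T}
    (hω : ∀ t j, ω ∉ deviationSet pick η s t j) :
    worstCaseRisk B (avgEstimator pick ω) ≤ bayesRisk d B (lfPrior pick ω) + ENNReal.ofReal
      (8 * B * (B + 1) * w + B / η / T + (gridSize B w * (s * (4 * B ^ 2)) +
        8 * B * (B + 1) * (B * (Real.exp (η * (2 * (8 * B * (B + 1)))) -
          Real.exp (-(η * (2 * (8 * B * (B + 1))))))) +
        2 * ((Real.log (2 * gridSize B w) + 4 * B ^ 4 * T / N₁ * l ^ 2 / 2) / l))) := by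
  have hT : (0 : ℝ) < T := by exact_mod_cast Nat.pos_of_ne_zero (NeZero.ne T)
  refine iSup₂_le fun θ hθ => ?_
  have hθ' : ‖θ‖ ≤ B := by simpa [paramSpace] using hθ
  rw [risk_eq_ofReal (avgEstimator_mem hB.le hw ω) hθ']
  refine le_trans ?_ (add_le_add_left (ofReal_avg_roundValue_le_bayesRisk hB.le hw ω) _)
  refine le_trans (ENNReal.ofReal_le_ofReal ?_) ENNReal.ofReal_add_le
  -- Symmetry moves θ to ‖θ‖ e₁, and the Lipschitz bound moves that to a grid point within w.
  obtain ⟨k, hk⟩ := exists_gridPoint_near hw hn (norm_nonneg θ) hθ'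
  have h1 (t : Fin T) : realRisk (iterate pick ω t) θ ≤
      gridRisk pick ω t k + 8 * B * (B + 1) * w := by
    have hmem := iterate_mem (pick := pick) hB.le hw ω t
    have hθn : ‖‖θ‖ • e₁ d‖ = ‖θ‖ := by rw [norm_smul_e₁, abs_norm]
    have h2 : realRisk (iterate pick ω t) θ = realRisk (iterate pick ω t) (‖θ‖ • e₁ d) := by
      have h3 : risk (iterate pick ω t) θ = risk (iterate pick ω t) (‖θ‖ • e₁ d) :=
        risk_minOracle_eq hmem.1 hθn.symm
      rw [risk_eq_ofReal hmem hθ', risk_eq_ofReal hmem (hθn.trans_le hθ')] at h3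
      exact (ENNReal.ofReal_eq_ofReal_iff (realRisk_nonneg _ _) (realRisk_nonneg _ _)).1 h3
    have h4 := realRisk_sub_le hmem (hθn.trans_le hθ')
      (norm_gridPoint_smul_le (d := d) hB.le hw k)
    rw [← sub_smul, norm_smul_e₁] at h4
    have h5 : 8 * B * (B + 1) * |‖θ‖ - gridPoint B w k| ≤ 8 * B * (B + 1) * w := by gcongr
    rw [h2, gridRisk]
    linarith
  have h2 := sum_gridRisk_le hp hB hw hN₁ hη hs hl hω k
  set R := (gridSize B w * (s * (4 * B ^ 2)) +
        8 * B * (B + 1) * (B * (Real.exp (η * (2 * (8 * B * (B + 1)))) -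
          Real.exp (-(η * (2 * (8 * B * (B + 1))))))) +
        2 * ((Real.log (2 * gridSize B w) + 4 * B ^ 4 * T / N₁ * l ^ 2 / 2) / l))
  have h3 := Finset.sum_le_sum fun (t : Fin T) (_ : t ∈ Finset.univ) => h1 t
  rw [Finset.sum_add_distrib] at h3
  simp only [Finset.sum_const, Finset.card_univ, Fintype.card_fin, nsmul_eq_mul] at h3
  refine (realRisk_avgEstimator_le hB.le hw ω hθ').trans ?_
  rw [one_div_mul_eq_div, one_div_mul_eq_div, div_le_iff₀ hT, add_mul, add_mul, add_mul,
    div_mul_cancel₀ _ hT.ne', div_mul_cancel₀ _ hT.ne']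
  linarith

end Value

/-! ### The parameters of the algorithm -/

lemma rpow_three_halves {x : ℝ} (hx : 0 ≤ x) : x ^ (3 / 2 : ℝ) = Real.sqrt x ^ 3 := by
  rw [Real.sqrt_eq_rpow, ← Real.rpow_natCast, ← Real.rpow_mul hx]
  norm_num

lemma one_le_sqrt_natCast {T : ℕ} (hT : 1 ≤ T) : 1 ≤ Real.sqrt T := by
  rw [Real.one_le_sqrt]
  exact_mod_cast hT

lemma widthParam_eq (B : ℝ) (T : ℕ) : widthParam B T = B / Real.sqrt T ^ 3 := by
  rw [widthParam, rpow_three_halves (by positivity)]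

lemma widthParam_pos {B : ℝ} (hB : 0 < B) {T : ℕ} (hT : 1 ≤ T) : 0 < widthParam B T := by
  have := one_le_sqrt_natCast hT
  rw [widthParam_eq]
  positivity

lemma div_widthParam {B : ℝ} (hB : 0 < B) {T : ℕ} (hT : 1 ≤ T) :
    B / widthParam B T = Real.sqrt T ^ 3 := by
  have := one_le_sqrt_natCast hT
  rw [widthParam_eq]
  field_simp

lemma gridSize_widthParam_pos {B : ℝ} (hB : 0 < B) {T : ℕ} (hT : 1 ≤ T) :
    0 < gridSize B (widthParam B T) := by
  rw [gridSize, div_widthParam hB hT, Nat.floor_pos]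
  exact one_le_pow₀ (one_le_sqrt_natCast hT)

lemma gridSize_widthParam_le {B : ℝ} (hB : 0 < B) {T : ℕ} (hT : 1 ≤ T) :
    (gridSize B (widthParam B T) : ℝ) ≤ Real.sqrt T ^ 3 := by
  rw [← div_widthParam hB hT]
  exact Nat.floor_le (div_nonneg hB.le (widthParam_pos hB hT).le)

lemma etaParam_pos {B : ℝ} (hB : 0 < B) {T : ℕ} (hT : 1 ≤ T) : 0 < etaParam B T := by
  have := one_le_sqrt_natCast hT
  rw [etaParam]
  positivity

lemma N₁Param_pos {B : ℝ} (hB : 0 < B) {T : ℕ} (hT : 1 ≤ T) : 0 < N₁Param B T :=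
  Nat.ceil_pos.2 (by positivity)

lemma N₂Param_pos {B : ℝ} (hB : 0 < B) {T : ℕ} (hT : 1 ≤ T) : 0 < N₂Param B T :=
  Nat.ceil_pos.2 (by positivity)

lemma exp_sub_exp_neg_le {x : ℝ} : Real.exp x - Real.exp (-x) ≤ 2 * x * Real.exp x := by
  have h1 := Real.add_one_le_exp (-2 * x)
  have h2 : Real.exp (-x) = Real.exp (-2 * x) * Real.exp x := by rw [← Real.exp_add]; ring_nf
  rw [h2]
  nlinarith [Real.exp_pos x]

/-- The accuracy asked of the empirical frequencies. -/
def freqTol (B : ℝ) (T : ℕ) (δ : ℝ) : ℝ := 2 * (1 + Real.log (T / δ)) * (B + 1) / (T : ℝ) ^ 2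

lemma log_div_nonneg {T : ℕ} (hT : 1 ≤ T) {δ : ℝ} (hδ : 0 < δ) (hδ1 : δ < 1) :
    0 ≤ Real.log (T / δ) := by
  have h1 : (1 : ℝ) ≤ T := by exact_mod_cast hT
  exact Real.log_nonneg (by rw [one_le_div hδ]; linarith)

lemma freqTol_failure_le {B : ℝ} (hB : 0 < B) {T : ℕ} (hT : 1 ≤ T) {δ : ℝ} (hδ : 0 < δ)
    (hδ1 : δ < 1) :
    T * gridSize B (widthParam B T) *
      (2 * Real.exp (-(2 * N₂Param B T * freqTol B T δ ^ 2))) ≤ δ := by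
  have hT1 : (1 : ℝ) ≤ T := by exact_mod_cast hT
  have hl := log_div_nonneg hT hδ hδ1
  set l := Real.log (T / δ) with hldef
  have hN : (T : ℝ) ^ 4 / (B + 1) ^ 2 ≤ N₂Param B T := Nat.le_ceil _
  -- The tolerance makes the exponent at least 8(1 + l)² ≥ 1 + 3l, so each failure probability is of
  -- order (δ/T)³: this pays for T rounds and at most T² grid points.
  have h1 : 8 * (1 + l) ^ 2 ≤ 2 * N₂Param B T * freqTol B T δ ^ 2 := by
    calc 8 * (1 + l) ^ 2 = 2 * ((T : ℝ) ^ 4 / (B + 1) ^ 2) * freqTol B T δ ^ 2 := by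
          rw [freqTol, ← hldef]; field_simp; ring
      _ ≤ _ := by gcongr
  have h2 : Real.exp (-(2 * N₂Param B T * freqTol B T δ ^ 2)) ≤ Real.exp (-1) * (δ / T) ^ 3 := by
    have h3 : (δ / T) ^ 3 = Real.exp (-(3 * l)) := by
      have : δ / T = Real.exp (-l) := by
        rw [Real.exp_neg, hldef, Real.exp_log (by positivity), inv_div]
      rw [this, ← Real.exp_nat_mul]
      congr 1; push_cast; ring
    rw [h3, ← Real.exp_add]
    apply Real.exp_le_exp.2
    nlinarith
  have h4 : Real.exp (-1) ≤ 1 / 2 := by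
    rw [Real.exp_neg, one_div]
    gcongr
    have := Real.add_one_le_exp (1 : ℝ)
    linarith
  have hn : (gridSize B (widthParam B T) : ℝ) ≤ T ^ 2 := by
    refine (gridSize_widthParam_le hB hT).trans ?_
    have hq := one_le_sqrt_natCast hT
    calc Real.sqrt T ^ 3 ≤ Real.sqrt T ^ 4 := pow_le_pow_right₀ hq (by norm_num)
      _ = (Real.sqrt T ^ 2) ^ 2 := by ring
      _ = (T : ℝ) ^ 2 := by rw [Real.sq_sqrt (by positivity)]
  calc _ ≤ T * (T : ℝ) ^ 2 * (2 * (1 / 2 * (δ / T) ^ 3)) := by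
        gcongr
        exact h2.trans (by gcongr)
    _ = δ ^ 3 := by field_simp
    _ ≤ δ := by
        calc δ ^ 3 ≤ δ ^ 1 := pow_le_pow_of_le_one hδ.le hδ1.le (by norm_num)
          _ = δ := pow_one δ

/-- In units of ρ = B²(B + 1)/√T the terms are: grid 8, perturbation 1, frequencies 8(1 + log(T/δ)),
stability 256 e¹⁶, Monte Carlo 12. Only the frequencies carry a logarithm, so k = 1 suffices. -/
lemma total_error_le {B : ℝ} (hB : 0 < B) {T : ℕ} (hT : 1 ≤ T) {δ : ℝ} (hδ : 0 < δ)
    (hδ1 : δ < 1) :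
    8 * B * (B + 1) * widthParam B T + B / etaParam B T / T +
      (gridSize B (widthParam B T) * (freqTol B T δ * (4 * B ^ 2)) +
        8 * B * (B + 1) * (B * (Real.exp (etaParam B T * (2 * (8 * B * (B + 1)))) -
          Real.exp (-(etaParam B T * (2 * (8 * B * (B + 1))))))) +
        2 * ((Real.log (2 * gridSize B (widthParam B T)) + 4 * B ^ 4 * T / N₁Param B T *
          (T / (B ^ 2 * (B + 1))) ^ 2 / 2) / (T / (B ^ 2 * (B + 1))))) ≤
      (256 * Real.exp 16 + 29) * (B ^ 2 * (B + 1) / Real.sqrt T) * (1 + Real.log (T / δ)) ^ 1 := by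
  have hl := log_div_nonneg hT hδ hδ1
  set l := Real.log (T / δ) with hldef
  set q := Real.sqrt T with hq
  have hq1 : 1 ≤ q := one_le_sqrt_natCast hT
  have hqT : (T : ℝ) = q ^ 2 := (Real.sq_sqrt (by positivity)).symm
  have hn := gridSize_widthParam_le hB hT
  have hn0 : (0 : ℝ) < gridSize B (widthParam B T) := by
    exact_mod_cast gridSize_widthParam_pos hB hT
  set n : ℝ := (gridSize B (widthParam B T) : ℝ)
  set ρ := B ^ 2 * (B + 1) / q with hρ
  have hρ0 : 0 < ρ := by positivity
  have t1 : 8 * B * (B + 1) * widthParam B T ≤ 8 * ρ := by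
    rw [widthParam_eq, hρ]
    have : B / q ^ 3 ≤ B / q := by
      gcongr
      exact le_self_pow₀ hq1 (by norm_num)
    calc 8 * B * (B + 1) * (B / q ^ 3) ≤ 8 * B * (B + 1) * (B / q) := by gcongr
      _ = _ := by ring
  have t2 : B / etaParam B T / T = ρ := by
    rw [etaParam, hρ, ← hq, hqT]
    field_simp
  have t3 : n * (freqTol B T δ * (4 * B ^ 2)) ≤ 8 * ρ * (1 + l) := by
    rw [freqTol, ← hldef, hqT, hρ]
    calc _ ≤ q ^ 3 * (2 * (1 + l) * (B + 1) / (q ^ 2) ^ 2 * (4 * B ^ 2)) := by gcongr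
      _ = _ := by field_simp; ring
  have t4 : 8 * B * (B + 1) * (B * (Real.exp (etaParam B T * (2 * (8 * B * (B + 1)))) -
      Real.exp (-(etaParam B T * (2 * (8 * B * (B + 1))))))) ≤ 256 * Real.exp 16 * ρ := by
    -- This is 2Lη; since it is at most 16, the exponential is bounded by e¹⁶.
    have h1 : etaParam B T * (2 * (8 * B * (B + 1))) = 16 / q := by
      rw [etaParam, ← hq]
      field_simp
      norm_num
    have h2 : 16 / q ≤ 16 := div_le_self (by norm_num) hq1
    rw [h1]
    calc _ ≤ 8 * B * (B + 1) * (B * (2 * (16 / q) * Real.exp (16 / q))) := by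
          gcongr
          exact exp_sub_exp_neg_le
      _ ≤ 8 * B * (B + 1) * (B * (2 * (16 / q) * Real.exp 16)) := by gcongr
      _ = _ := by rw [hρ]; ring
  -- With l = T/(B²(B + 1)) the variance term is at most 2. Dividing by l gains a factor 1/T, which
  -- leaves room for the crude bound log(2n) ≤ 4√T.
  have t5 : 2 * ((Real.log (2 * n) + 4 * B ^ 4 * T / N₁Param B T *
      (T / (B ^ 2 * (B + 1))) ^ 2 / 2) / (T / (B ^ 2 * (B + 1)))) ≤ 12 * ρ := by
    have h1 : Real.log (2 * n) ≤ 4 * q := by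
      have h2 : Real.log (2 * n) ≤ Real.log 2 + 3 * Real.log q := by
        rw [Real.log_mul (by norm_num) hn0.ne']
        have := Real.log_le_log hn0 hn
        rw [Real.log_pow] at this
        push_cast at this
        linarith
      have h3 : Real.log q ≤ q - 1 := Real.log_le_sub_one_of_pos (by positivity)
      have h4 : Real.log 2 ≤ 1 := by
        have := Real.log_le_sub_one_of_pos (show (0 : ℝ) < 2 by norm_num)
        linarith
      linarith
    have h5 : 4 * B ^ 4 * T / N₁Param B T * (T / (B ^ 2 * (B + 1))) ^ 2 / 2 ≤ 2 * q := by
      have hN : (T : ℝ) ^ 3 / (B + 1) ^ 2 ≤ N₁Param B T := Nat.le_ceil _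
      calc _ ≤ 4 * B ^ 4 * T / ((T : ℝ) ^ 3 / (B + 1) ^ 2) * (T / (B ^ 2 * (B + 1))) ^ 2 / 2 := by
            gcongr
        _ = 2 := by rw [hqT]; field_simp; norm_num
        _ ≤ 2 * q := by linarith
    calc _ ≤ 2 * ((4 * q + 2 * q) / (T / (B ^ 2 * (B + 1)))) := by gcongr
      _ = 12 * ρ := by rw [hqT, hρ]; field_simp; norm_num
  rw [t2, pow_one]
  have h6 : 0 ≤ ρ * l := by positivity
  have h7 : 0 ≤ Real.exp 16 * (ρ * l) := by positivity
  nlinarith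

end GaussianSequence

end

/-! ### The main theorem: one good event for both claims -/

open GaussianSequence in
theorem theorem5 :
    ∃ (C : ℝ) (k : ℕ), 0 < C ∧
      ∀ (d : ℕ) [NeZero d] (B : ℝ), 0 < B → ∀ T : ℕ, 1 ≤ T → ∀ δ : ℝ, 0 < δ → δ < 1 →
      ∀ pick : (Fin (gridSize B (widthParam B T)) → ℝ) → Fin (gridSize B (widthParam B T)),
      ArgmaxRule (gridSize B (widthParam B T)) pick →
        -- the averaged estimator is an estimator, and it is approximately minimax
        (∀ ω : Seed d B (widthParam B T) (N₁Param B T) (N₂Param B T) T,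
          avgEstimator pick ω ∈ detEstimators d B) ∧
        seedLaw d B (etaParam B T) (widthParam B T) (N₁Param B T) (N₂Param B T) T
          {ω | ¬ worstCaseRisk B (avgEstimator pick ω) ≤
            minimaxRisk d B + errorBound C k B T δ} ≤ ENNReal.ofReal δ ∧
        -- the radially extended prior is a prior, and it is approximately least favorable
        (∀ ω : Seed d B (widthParam B T) (N₁Param B T) (N₂Param B T) T,
          IsProbabilityMeasure (lfPrior pick ω) ∧ lfPrior pick ω (paramSpace d B)ᶜ = 0) ∧
        seedLaw d B (etaParam B T) (widthParam B T) (N₁Param B T) (N₂Param B T) T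
          {ω | ¬ minimaxRisk d B ≤
            bayesRisk d B (lfPrior pick ω) + errorBound C k B T δ} ≤ ENNReal.ofReal δ := by
  refine ⟨256 * Real.exp 16 + 29, 1, by positivity, ?_⟩
  intro d _ B hB T hT δ hδ hδ1 pick hp
  have hw := widthParam_pos hB hT
  have hη := etaParam_pos hB hT
  have : NeZero (N₂Param B T) := ⟨(N₂Param_pos hB hT).ne'⟩
  have : NeZero T := ⟨by omega⟩
  have hT0 : (0 : ℝ) < T := by exact_mod_cast hT
  have hl := log_div_nonneg hT hδ hδ1
  have hs : 0 ≤ freqTol B T δ := by unfold freqTol; positivity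
  set bad : Set (Seed d B (widthParam B T) (N₁Param B T) (N₂Param B T) T) :=
    ⋃ (t : Fin T) (j : Fin (gridSize B (widthParam B T))),
      deviationSet pick (etaParam B T) (freqTol B T δ) t j
  have hbad : seedLaw d B (etaParam B T) (widthParam B T) (N₁Param B T) (N₂Param B T) T bad ≤
      ENNReal.ofReal δ :=
    (seedLaw_iUnion_deviationSet_le hp hB.le hw hη hs).trans
      (ENNReal.ofReal_le_ofReal (freqTol_failure_le hB hT hδ hδ1))
  have hgood : ∀ ω ∉ bad, worstCaseRisk B (avgEstimator pick ω) ≤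
      bayesRisk d B (lfPrior pick ω) + errorBound (256 * Real.exp 16 + 29) 1 B T δ := by
    intro ω hω
    have hω' : ∀ t j, ω ∉ deviationSet pick (etaParam B T) (freqTol B T δ) t j := fun t j h =>
      hω (Set.mem_iUnion₂.2 ⟨t, j, h⟩)
    refine (worstCaseRisk_avgEstimator_le (l := T / (B ^ 2 * (B + 1))) hp hB hw
      (gridSize_widthParam_pos hB hT) (N₁Param_pos hB hT) hη hs (by positivity) hω').trans ?_
    gcongr
    exact ENNReal.ofReal_le_ofReal (total_error_le hB hT hδ hδ1)
  have hprior (ω : Seed d B (widthParam B T) (N₁Param B T) (N₂Param B T) T) :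
      lfPrior pick ω (paramSpace d B)ᶜ = 0 := lfPrior_compl_paramSpace hB.le hw ω
  -- Both failure events lie in `bad`; monotonicity of the measure does not require them to be
  -- measurable.
  refine ⟨fun ω => avgEstimator_mem hB.le hw ω, (measure_mono fun ω hω => ?_).trans hbad,
    fun ω => ⟨inferInstance, hprior ω⟩, (measure_mono fun ω hω => ?_).trans hbad⟩
  · by_contra hc
    refine hω ((hgood ω hc).trans ?_)
    gcongr
    exact bayesRisk_le_minimaxRisk _ (ae_iff.2 (hprior ω))
  · by_contra hc
    exact hω ((minimaxRisk_le_worstCaseRisk (avgEstimator_mem hB.le hw ω)).trans (hgood ω hc))
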